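/- Let $n\ge 1$, $a\in\mathbb C^n$, $0<\rho<\infty$, and let $D=\{z\in\mathbb C^n: |z_j-a_j|<\rho,\ j=1,\dots,n\}$. A function $u:D\to\mathbb R$ is *$n$-harmonic* if it is continuous and harmonic in each variable separately. Let $H=H^2(D)$ be the complex vector space of analytic functions $h:D\to\mathbb C$ such that $|h|^2$ has an $n$-harmonic majorant. Let $R$ be either the algebra of polynomials in $z_1,\dots,z_n$, regarded as functions on $D$, or the algebra $H^\infty(D)$ of bounded analytic functions on $D$. For an analytic function $f$ on $D$ let $\operatorname{ord}(f)\in\{0,1,2,\dots\}\cup\{\infty\}$ be the order of the zero of $f$ at $a$: the least degree of a non-zero homogeneous term of the power series of $f$ around $a$ ($\infty$ if $f=0$). **Theorem.** For every $h\in H$ the function $|h|^2$ has a least $n$-harmonic majorant $u_h$. There is an inner product on $H$ with $\|h\|^2=u_h(a)$ for all $h\in H$, and $H$ is complete in this norm. With this Hilbert space structure, for either choice of $R$, $H$ is an *analytic Hilbert module* over $R$ on $D$ with basepoint $a$; that is: 1. $\operatorname{ord}$ is an analytic valuation on $R$: for $r,s\in R$ and $0\neq\lambda\in\mathbb C$,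 $\operatorname{ord}(r)=0$ if $r$ is invertible in $R$; $\operatorname{ord}(r)=\infty$ iff $r=0$; $\operatorname{ord}(rs)\ge\operatorname{ord}(r)+\operatorname{ord}(s)$; $\operatorname{ord}(\lambda r)=\operatorname{ord}(r)$; $\operatorname{ord}(r+s)\ge\min(\operatorname{ord}(r),\operatorname{ord}(s))$. 2. $H$ is an $R$-module under pointwise multiplication, and $h\mapsto rh$ is norm continuous on $H$ for every $r\in R$. 3. $\operatorname{ord}$ is a Hilbert module valuation on $H$: for $h,h_1,h_2\in H$, $r\in R$ and $0\ne\lambda\in\mathbb C$, $\operatorname{ord}(h)=\infty$ iff $h=0$; $\operatorname{ord}(rh)\ge\operatorname{ord}(r)+\operatorname{ord}(h)$; $\operatorname{ord}(\lambda h)=\operatorname{ord}(h)$; $\operatorname{ord}(h_1+h_2)\ge\min(\operatorname{ord}(h_1),\operatorname{ord}(h_2))$; and $\operatorname{ord}$ is upper semicontinuous on $H$ in the norm topology. 4. There is an open set $U$ with $a\in U\subseteq D$ such that every sequence converging in the norm of $H$ converges, to the same limit, uniformly on each compact subset of $U$. Moreover, the closed invariant subspaces of $H$ are described as follows. Put $R_1=\{r\in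 R:\operatorname{ord}(r)\ge1\}$. For a closed subspace $V\subseteq H$ and $k\ge0$ put $V_k=\{h\in V:\operatorname{ord}(h)\ge k\}$ and $W_k=V_k\ominus V_{k+1}$ (the orthogonal complement of $V_{k+1}$ in $V_k$), and let $P_k$ be the orthogonal projection of $H$ onto the subspace $W_k$ formed for $V=H$. The following are equivalent for every closed subspace $V$ of $H$: * (a) $rV\subseteq V$ for all $r\in R_1$; * (b) $rV\subseteq V$ for all $r\in R$; * (c) for all $k,m\ge0$, $h\in W_k$, $g\in V$ and $r\in R_1$: if $\operatorname{ord}(rh-g)>m$ then $rh-g\perp W_m$; and if $\operatorname{ord}(rh-g)\ge m$ then $P_m(rh-g)\in P_m(W_m)$. -/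

import Mathlib

open Set Filter Topology

noncomputable section

/-! ## Valuation Hilbert modules -/

section Valuation

variable {R H : Type*} [CommRing R] [Algebra ℂ R]
  [NormedAddCommGroup H] [InnerProductSpace ℂ H] [Module R H]

/-- An analytic valuation on a commutative complex algebra. -/
structure IsAnalyticValuation (ordR : R → ℕ∞) : Prop where
  ord_unit : ∀ r : R, IsUnit r → ordR r = 0
  ord_eq_top_iff : ∀ r : R, ordR r = ⊤ ↔ r = 0
  ord_mul : ∀ r s : R, ordR r + ordR s ≤ ordR (r * s)
  ord_smul : ∀ (c : ℂ) (r : R), c ≠ 0 → ordR (c • r) = ordR r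
  ord_add : ∀ r s : R, min (ordR r) (ordR s) ≤ ordR (r + s)

/-- A Hilbert module valuation on `H` with respect to `ordR`; semicontinuity is with respect
to the norm topology of `H`. -/
structure IsHilbertModuleValuation (ordR : R → ℕ∞) (ordH : H → ℕ∞) : Prop where
  ord_eq_top_iff : ∀ h : H, ordH h = ⊤ ↔ h = 0
  ord_mod_smul : ∀ (r : R) (h : H), ordR r + ordH h ≤ ordH (r • h)
  ord_smul : ∀ (c : ℂ) (h : H), c ≠ 0 → ordH (c • h) = ordH h
  ord_add : ∀ h₁ h₂ : H, min (ordH h₁) (ordH h₂) ≤ ordH (h₁ + h₂)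
  upperSemicontinuous : UpperSemicontinuous ordH

/-- `(H, ordH)` is a valuation Hilbert module over the valuation algebra `(R, ordR)`: `H` is a
Hilbert space and a module over the complex algebra `R`, every `r : R` acts continuously, and
`ordR`, `ordH` are valuations. -/
structure IsValuationHilbertModule (ordR : R → ℕ∞) (ordH : H → ℕ∞) : Prop where
  complete : CompleteSpace H
  smul_assoc : ∀ (c : ℂ) (r : R) (h : H), (c • r) • h = c • (r • h)
  continuous_smul : ∀ r : R, Continuous fun h : H => r • h
  algebraValuation : IsAnalyticValuation ordR
  moduleValuation : IsHilbertModuleValuation ordR ordH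

namespace IsValuationHilbertModule

variable {ordR : R → ℕ∞} {ordH : H → ℕ∞}

/-- The valuation subspace series `V_k = {h ∈ V : ord h ≥ k}`. -/
def subspaceSeries (hv : IsValuationHilbertModule ordR ordH) (V : Submodule ℂ H) (k : ℕ) :
    Submodule ℂ H where
  carrier := {h | h ∈ V ∧ (k : ℕ∞) ≤ ordH h}
  add_mem' := fun {x y} hx hy =>
    ⟨V.add_mem hx.1 hy.1, (le_min hx.2 hy.2).trans (hv.moduleValuation.ord_add x y)⟩
  zero_mem' := ⟨V.zero_mem, by rw [(hv.moduleValuation.ord_eq_top_iff 0).2 rfl]; exact le_top⟩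
  smul_mem' := fun c x hx => by
    refine ⟨V.smul_mem c hx.1, ?_⟩
    by_cases hc : c = 0
    · rw [hc, zero_smul, (hv.moduleValuation.ord_eq_top_iff 0).2 rfl]; exact le_top
    · rw [hv.moduleValuation.ord_smul c x hc]; exact hx.2

/-- The valuation homogeneous component `W_k = V_k ⊖ V_{k+1}`. -/
def component (hv : IsValuationHilbertModule ordR ordH) (V : Submodule ℂ H) (k : ℕ) :
    Submodule ℂ H :=
  hv.subspaceSeries V k ⊓ (hv.subspaceSeries V (k + 1))ᗮ

theorem isClosed_subspaceSeries (hv : IsValuationHilbertModule ordR ordH) (V : Submodule ℂ H)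
    (hV : IsClosed (V : Set H)) (k : ℕ) : IsClosed (hv.subspaceSeries V k : Set H) := by
  have h1 : IsClosed {h : H | (k : ℕ∞) ≤ ordH h} :=
    hv.moduleValuation.upperSemicontinuous.isClosed_preimage (k : ℕ∞)
  exact hV.inter h1

theorem hasOrthogonalProjection_component (hv : IsValuationHilbertModule ordR ordH) (k : ℕ) :
    (hv.component ⊤ k).HasOrthogonalProjection := by
  have := hv.complete
  have h1 : IsClosed (hv.component ⊤ k : Set H) :=
    (hv.isClosed_subspaceSeries ⊤ isClosed_univ k).inter
      (Submodule.isClosed_orthogonal _)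
  have : CompleteSpace (hv.component ⊤ k) := h1.completeSpace_coe
  infer_instance

/-- The orthogonal projection of `H` onto the `k`-th homogeneous component of `H` itself. -/
def proj (hv : IsValuationHilbertModule ordR ordH) (k : ℕ) : H →L[ℂ] H :=
  haveI := hv.hasOrthogonalProjection_component k
  (hv.component ⊤ k).starProjection

/-- The valuation homogeneous decomposition of `V` is `R₁` inner. -/
def IsInner (hv : IsValuationHilbertModule ordR ordH) (V : Submodule ℂ H) : Prop :=
  ∀ k m : ℕ, ∀ h ∈ hv.component V k, ∀ g ∈ V, ∀ r : R, 1 ≤ ordR r →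
    (m : ℕ∞) < ordH (r • h - g) → r • h - g ∈ (hv.component V m)ᗮ

/-- The valuation homogeneous decomposition of `V` has the full projection property. -/
def HasFullProjection (hv : IsValuationHilbertModule ordR ordH) (V : Submodule ℂ H) : Prop :=
  ∀ k m : ℕ, ∀ r : R, 1 ≤ ordR r → ∀ h ∈ hv.component V k, ∀ g ∈ V,
    (m : ℕ∞) ≤ ordH (r • h - g) →
      hv.proj m (r • h - g) ∈ hv.proj m '' (hv.component V m : Set H)

/-- `V` is invariant under `R₁ = {r : ord r ≥ 1}`. -/
def IsInvariantOne (_ : IsValuationHilbertModule ordR ordH) (V : Submodule ℂ H) : Prop :=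
  ∀ r : R, 1 ≤ ordR r → ∀ h ∈ V, r • h ∈ V

/-- `V` is invariant under `R`, that is, an `R` submodule. -/
def IsInvariant (_ : IsValuationHilbertModule ordR ordH) (V : Submodule ℂ H) : Prop :=
  ∀ r : R, ∀ h ∈ V, r • h ∈ V

/-- The description of the closed `R₁` invariant subspaces and of the closed `R` submodules by
means of the valuation homogeneous decomposition. -/
def BeurlingDescription (hv : IsValuationHilbertModule ordR ordH) : Prop :=
  ∀ V : Submodule ℂ H, IsClosed (V : Set H) →
    (hv.IsInvariantOne V ↔ hv.IsInner V ∧ hv.HasFullProjection V) ∧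
    (hv.IsInvariant V ↔ hv.IsInner V ∧ hv.HasFullProjection V)

end IsValuationHilbertModule

end Valuation

/-! ## Analytic Hilbert modules on domains of `ℂⁿ` -/

/-- Extension by zero of a function on a set. -/
def zeroExt {X E : Type*} [Zero E] {Ω : Set X} (f : Ω → E) : X → E :=
  Function.extend Subtype.val f 0

theorem zeroExt_apply {X E : Type*} [Zero E] {Ω : Set X} (f : Ω → E) {x : X} (hx : x ∈ Ω) :
    zeroExt f x = f ⟨x, hx⟩ :=
  Subtype.val_injective.extend_apply f 0 (⟨x, hx⟩ : Ω)

/-- Analytic functions on `Ω` (meant for open `Ω`). -/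
def IsAnalyticFun {n : ℕ} {Ω : Set (Fin n → ℂ)} (f : Ω → ℂ) : Prop :=
  AnalyticOnNhd ℂ (zeroExt f) Ω

/-- The order of the zero of `f` at `a`: the least degree of a homogeneous term
`z ↦ p k (z, …, z)` of the power series of `f` around `a` that does not vanish identically
(`⊤` if there is none). -/
def zeroOrder {n : ℕ} {Ω : Set (Fin n → ℂ)} (a : Fin n → ℂ) (f : Ω → ℂ) : ℕ∞ :=
  ⨅ (k : ℕ) (_ : ∃ p : FormalMultilinearSeries ℂ (Fin n → ℂ) ℂ,
    HasFPowerSeriesAt (zeroExt f) p a ∧ ∃ z : Fin n → ℂ, p k (fun _ => z) ≠ 0), (k : ℕ∞)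

/-- `H`, whose elements are regarded as functions on `Ω` through `ι`, is an analytic Hilbert
module over the algebra `R` of functions on the domain `Ω` of `ℂⁿ` with basepoint `a`. -/
structure IsAnalyticHilbertModule {n : ℕ} (Ω : Set (Fin n → ℂ)) (a : Fin n → ℂ)
    (R : Subalgebra ℂ (Ω → ℂ)) {H : Type*} [NormedAddCommGroup H] [InnerProductSpace ℂ H]
    [Module R H] (ι : H →ₗ[ℂ] (Ω → ℂ)) : Prop where
  isOpen : IsOpen Ω
  isConnected : IsConnected Ω
  base_mem : a ∈ Ω
  analytic_algebra : ∀ r ∈ R, IsAnalyticFun r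
  injective : Function.Injective ι
  analytic_space : ∀ h : H, IsAnalyticFun (ι h)
  /-- The module operations are pointwise. -/
  pointwise : ∀ (r : R) (h : H) (z : Ω), ι (r • h) z = (r : Ω → ℂ) z * ι h z
  /-- With the standard order functions, `H` is a valuation Hilbert module over `R`. -/
  valuation : IsValuationHilbertModule (R := R) (H := H)
    (fun r => zeroOrder a (r : Ω → ℂ)) (fun h => zeroOrder a (ι h))
  /-- Norm convergence implies uniform convergence on compact subsets of a neighbourhood of
  the basepoint. -/
  locally_uniform : ∃ U : Set (Fin n → ℂ), IsOpen U ∧ a ∈ U ∧ U ⊆ Ω ∧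
    ∀ (hs : ℕ → H) (h : H), Tendsto hs atTop (𝓝 h) → ∀ K : Set (Fin n → ℂ), IsCompact K → K ⊆ U →
      TendstoUniformlyOn (fun j => zeroExt (ι (hs j))) (zeroExt (ι h)) atTop K

/-! ## The polydisk -/

/-- The open polydisk of radius `ρ` centered at `a`. -/
def polydisk {n : ℕ} (a : Fin n → ℂ) (ρ : ℝ) : Set (Fin n → ℂ) :=
  {z | ∀ j, ‖z j - a j‖ < ρ}

theorem center_mem_polydisk {n : ℕ} (a : Fin n → ℂ) {ρ : ℝ} (hρ : 0 < ρ) :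
    a ∈ polydisk a ρ := fun j => by simpa using hρ

/-- `n`-harmonic functions on the polydisk: continuous, and harmonic in each variable. -/
def IsNHarmonic {n : ℕ} {a : Fin n → ℂ} {ρ : ℝ} (u : polydisk a ρ → ℝ) : Prop :=
  Continuous u ∧ ∀ z ∈ polydisk a ρ, ∀ j : Fin n,
    InnerProductSpace.HarmonicOnNhd (fun w : ℂ => zeroExt u (Function.update z j w))
      {w | ‖w - a j‖ < ρ}

/-- The `n`-harmonic majorants of `|h|²`. -/
def nHarmonicMajorants {n : ℕ} {a : Fin n → ℂ} {ρ : ℝ} (h : polydisk a ρ → ℂ) :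
    Set (polydisk a ρ → ℝ) :=
  {u | IsNHarmonic u ∧ ∀ z, ‖h z‖ ^ 2 ≤ u z}

theorem zeroExt_add {X E : Type*} [AddZeroClass E] {Ω : Set X} (f g : Ω → E) :
    zeroExt (f + g) = zeroExt f + zeroExt g := by
  funext x
  by_cases hx : x ∈ Ω
  · simp [zeroExt_apply _ hx]
  · simp [zeroExt, Function.extend, hx]

theorem zeroExt_mul {X : Type*} {Ω : Set X} (f g : Ω → ℂ) :
    zeroExt (f * g) = zeroExt f * zeroExt g := by
  funext x
  by_cases hx : x ∈ Ω
  · simp [zeroExt_apply _ hx]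
  · simp [zeroExt, Function.extend, hx]

theorem zeroExt_smul {X 𝕜 : Type*} [Semiring 𝕜] {Ω : Set X} (c : 𝕜) (f : Ω → 𝕜) :
    zeroExt (c • f) = c • zeroExt f := by
  funext x
  by_cases hx : x ∈ Ω
  · simp [zeroExt_apply _ hx]
  · simp [zeroExt, Function.extend, hx]

theorem IsNHarmonic.add {n : ℕ} {a : Fin n → ℂ} {ρ : ℝ} {u v : polydisk a ρ → ℝ}
    (hu : IsNHarmonic u) (hv : IsNHarmonic v) : IsNHarmonic (u + v) := by
  refine ⟨hu.1.add hv.1, fun z hz j => ?_⟩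
  have := (hu.2 z hz j).add (hv.2 z hz j)
  rw [zeroExt_add]
  exact this

theorem IsNHarmonic.const_smul {n : ℕ} {a : Fin n → ℂ} {ρ : ℝ} {u : polydisk a ρ → ℝ}
    (hu : IsNHarmonic u) (c : ℝ) : IsNHarmonic (c • u) := by
  refine ⟨hu.1.const_smul c, fun z hz j => ?_⟩
  have := (hu.2 z hz j).const_smul (c := c)
  rw [zeroExt_smul]
  exact this

theorem IsAnalyticFun.add {n : ℕ} {Ω : Set (Fin n → ℂ)} {f g : Ω → ℂ}
    (hf : IsAnalyticFun f) (hg : IsAnalyticFun g) : IsAnalyticFun (f + g) := by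
  unfold IsAnalyticFun; rw [zeroExt_add]; exact AnalyticOnNhd.add hf hg

theorem IsAnalyticFun.mul {n : ℕ} {Ω : Set (Fin n → ℂ)} {f g : Ω → ℂ}
    (hf : IsAnalyticFun f) (hg : IsAnalyticFun g) : IsAnalyticFun (f * g) := by
  unfold IsAnalyticFun; rw [zeroExt_mul]; exact AnalyticOnNhd.mul hf hg

theorem isOpen_polydisk {n : ℕ} (a : Fin n → ℂ) (ρ : ℝ) : IsOpen (polydisk a ρ) := by
  have : polydisk a ρ = ⋂ j, {z : Fin n → ℂ | ‖z j - a j‖ < ρ} := by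
    ext z; simp [polydisk]
  rw [this]
  exact isOpen_iInter_of_finite fun j => isOpen_lt (by fun_prop) continuous_const

theorem isAnalyticFun_restrict {n : ℕ} {Ω : Set (Fin n → ℂ)} (hΩ : IsOpen Ω)
    {F : (Fin n → ℂ) → ℂ} (hF : AnalyticOnNhd ℂ F Ω) :
    IsAnalyticFun (fun z : Ω => F z) := by
  refine AnalyticOnNhd.congr hΩ hF fun x hx => ?_
  rw [zeroExt_apply _ hx]

/-- The functions of the space `H²` of the polydisk: the analytic functions `h` such that
`|h|²` admits an `n`-harmonic majorant. -/
def hardySubmodule {n : ℕ} (a : Fin n → ℂ) (ρ : ℝ) : Submodule ℂ (polydisk a ρ → ℂ) where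
  carrier := {h | IsAnalyticFun h ∧ (nHarmonicMajorants h).Nonempty}
  add_mem' := by
    rintro f g ⟨hf, u, hu, hfu⟩ ⟨hg, v, hv, hgv⟩
    refine ⟨hf.add hg, (2 : ℝ) • (u + v), (hu.add hv).const_smul 2, fun z => ?_⟩
    have h1 : ‖f z + g z‖ ≤ ‖f z‖ + ‖g z‖ := norm_add_le _ _
    have h2 := hfu z
    have h3 := hgv z
    have h4 : ‖f z + g z‖ ^ 2 ≤ (‖f z‖ + ‖g z‖) ^ 2 := by gcongr
    simp only [Pi.add_apply, Pi.smul_apply, smul_eq_mul]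
    nlinarith [sq_nonneg (‖f z‖ - ‖g z‖)]
  zero_mem' := by
    refine ⟨isAnalyticFun_restrict (F := fun _ => 0) (isOpen_polydisk a ρ) analyticOnNhd_const,
      0, ⟨continuous_const, fun z hz j => ?_⟩, fun z => by simp⟩
    have : (fun w : ℂ => zeroExt (0 : polydisk a ρ → ℝ) (Function.update z j w)) =
        fun _ => (0 : ℝ) := by
      funext w
      simp [zeroExt, Function.extend]
    rw [this]
    exact fun x _ => ⟨contDiffAt_const, by
      filter_upwards with y
      simp [InnerProductSpace.laplacian_const]⟩
  smul_mem' := by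
    rintro c f ⟨hf, u, hu, hfu⟩
    refine ⟨?_, (‖c‖ ^ 2) • u, hu.const_smul _, fun z => ?_⟩
    · unfold IsAnalyticFun; rw [zeroExt_smul]
      exact AnalyticOnNhd.smul (f := fun _ => c) analyticOnNhd_const hf
    · simp only [Pi.smul_apply, smul_eq_mul, norm_mul, mul_pow]
      exact mul_le_mul_of_nonneg_left (hfu z) (by positivity)

/-- `H²` of the polydisk, as a bare complex vector space of functions. -/
def HardySpace {n : ℕ} (a : Fin n → ℂ) (ρ : ℝ) : Type := hardySubmodule a ρ

instance {n : ℕ} (a : Fin n → ℂ) (ρ : ℝ) : AddCommGroup (HardySpace a ρ) :=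
  inferInstanceAs (AddCommGroup (hardySubmodule a ρ))

instance {n : ℕ} (a : Fin n → ℂ) (ρ : ℝ) : Module ℂ (HardySpace a ρ) :=
  inferInstanceAs (Module ℂ (hardySubmodule a ρ))

/-- The inclusion of `H²` into the functions on the polydisk. -/
def HardySpace.toFun {n : ℕ} (a : Fin n → ℂ) (ρ : ℝ) :
    HardySpace a ρ →ₗ[ℂ] (polydisk a ρ → ℂ) :=
  (hardySubmodule a ρ).subtype

/-- The algebra `H^∞` of bounded analytic functions on the polydisk. -/
def hInfty {n : ℕ} (a : Fin n → ℂ) (ρ : ℝ) : Subalgebra ℂ (polydisk a ρ → ℂ) where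
  carrier := {f | IsAnalyticFun f ∧ ∃ M : ℝ, ∀ z, ‖f z‖ ≤ M}
  add_mem' := by
    rintro f g ⟨hf, M, hM⟩ ⟨hg, N, hN⟩
    exact ⟨hf.add hg, M + N, fun z => (norm_add_le _ _).trans (add_le_add (hM z) (hN z))⟩
  mul_mem' := by
    rintro f g ⟨hf, M, hM⟩ ⟨hg, N, hN⟩
    refine ⟨hf.mul hg, M * N, fun z => ?_⟩
    rw [Pi.mul_apply, norm_mul]
    exact mul_le_mul (hM z) (hN z) (norm_nonneg _) ((norm_nonneg _).trans (hM z))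
  algebraMap_mem' := fun c =>
    ⟨isAnalyticFun_restrict (F := fun _ => c) (isOpen_polydisk a ρ) analyticOnNhd_const,
      ‖c‖, fun _ => le_rfl⟩

/-- The algebra of polynomial functions on the polydisk. -/
def polyAlg {n : ℕ} (a : Fin n → ℂ) (ρ : ℝ) : Subalgebra ℂ (polydisk a ρ → ℂ) :=
  (MvPolynomial.aeval
    (fun (j : Fin n) (z : polydisk a ρ) => (z : Fin n → ℂ) j) :
      MvPolynomial (Fin n) ℂ →ₐ[ℂ] (polydisk a ρ → ℂ)).range

theorem polyAlg_le_hInfty {n : ℕ} (a : Fin n → ℂ) (ρ : ℝ) : polyAlg a ρ ≤ hInfty a ρ := by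
  rw [polyAlg, ← Algebra.adjoin_range_eq_range_aeval, Algebra.adjoin_le_iff]
  rintro _ ⟨j, rfl⟩
  refine ⟨isAnalyticFun_restrict (F := fun z => z j) (isOpen_polydisk a ρ) ?_,
    ‖a j‖ + ρ, fun z => ?_⟩
  · exact (ContinuousLinearMap.proj (R := ℂ) (φ := fun _ : Fin n => ℂ) j).analyticOnNhd _
  · have h1 := z.2 j
    have h2 : ‖(z : Fin n → ℂ) j‖ ≤ ‖a j‖ + ‖(z : Fin n → ℂ) j - a j‖ := by
      have := norm_add_le (a j) ((z : Fin n → ℂ) j - a j)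
      simpa using this
    simp only at *
    linarith

theorem hInfty_mul_mem {n : ℕ} {a : Fin n → ℂ} {ρ : ℝ} {f h : polydisk a ρ → ℂ}
    (hf : f ∈ hInfty a ρ) (hh : h ∈ hardySubmodule a ρ) : f * h ∈ hardySubmodule a ρ := by
  obtain ⟨hf, M, hM⟩ := hf
  obtain ⟨hh, u, hu, hhu⟩ := hh
  refine ⟨hf.mul hh, (M ^ 2) • u, hu.const_smul _, fun z => ?_⟩
  simp only [Pi.mul_apply, Pi.smul_apply, smul_eq_mul, norm_mul, mul_pow]
  exact mul_le_mul (pow_le_pow_left₀ (norm_nonneg _) (hM z) 2) (hhu z) (by positivity)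
    (by positivity)

/-- `H^∞` acts on `H²` by pointwise multiplication. -/
instance {n : ℕ} (a : Fin n → ℂ) (ρ : ℝ) : Module (hInfty a ρ) (HardySpace a ρ) where
  smul f h := ⟨f.1 * h.1, hInfty_mul_mem f.2 h.2⟩
  one_smul h := Subtype.ext (one_mul h.1)
  mul_smul f g h := Subtype.ext (mul_assoc f.1 g.1 h.1)
  smul_zero f := Subtype.ext (mul_zero f.1)
  smul_add f g h := Subtype.ext (mul_add f.1 g.1 h.1)
  add_smul f g h := Subtype.ext (add_mul f.1 g.1 h.1)
  zero_smul h := Subtype.ext (zero_mul h.1)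

/-- Polynomials act on `H²` by pointwise multiplication. -/
instance {n : ℕ} (a : Fin n → ℂ) (ρ : ℝ) : Module (polyAlg a ρ) (HardySpace a ρ) :=
  Module.compHom (HardySpace a ρ) (Subalgebra.inclusion (polyAlg_le_hInfty a ρ)).toRingHom

end

/-! Expand `h` at `a` with coefficients `c α`. On the torus of radius `s < ρ`, `|h|²` is the double
series of `c α * conj (c β) * z ^ α * conj (z ^ β)`. Replacing every product `z j * conj (z j)` by
`s²` gives a function `poissonSq c s` that is harmonic in each variable and equals `|h|²` on the
torus. The minimum principle, used one variable at a time, gives `|h|² ≤ poissonSq c s ≤ v` on the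
polydisk of radius `s` for every `n`-harmonic majorant `v`. At the center only the terms `α = β`
survive, so `∑ |c α|² s ^ (2|α|) ≤ v a`. Hence a majorant forces `∑ |c α|² ρ ^ (2|α|) < ∞`;
conversely this makes the series converge for `s = ρ`, and `poissonSq c ρ`, the limit as `s → ρ`, is
the least majorant (`isLeast_poissonSq`). So the weighted coefficients `c α * ρ ^ |α|` identify `H²`
with `ℓ²`, which supplies the inner product and completeness. Coefficients and, locally uniformly,
point values are bounded by the norm; this gives semicontinuity of the order and uniform convergence
on compact sets.

The description of invariant subspaces is abstract. If `V` is `R₁` invariant, then `r • h - g` lies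
in `V`, and (c) follows from `V_m = W_m ⊕ V_{m+1}`. Conversely, let `h ∈ W_k` and let `f = r • h -
g` be the part of `r • h` orthogonal to `V`. If `ord f ≥ m`, full projection gives `w ∈ W_m` with
`ord (f - w) > m`; innerness gives `f - w ⊥ w`, and `f ⊥ w` too, so `w = 0` and the order of `f`
exceeds `m`. Thus `f` has infinite order and vanishes. The components span a dense subspace of `V`
and `r` acts continuously, so `V` is `R₁` invariant. Since `r - r(a)` lies in `R₁`, this is the same
as `R` invariance. -/

noncomputable section

/-! ### Invariant subspaces of abstract valuation Hilbert modules. -/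

namespace IsValuationHilbertModule

variable {R H : Type*} [CommRing R] [Algebra ℂ R]
  [NormedAddCommGroup H] [InnerProductSpace ℂ H] [Module R H]
  {ordR : R → ℕ∞} {ordH : H → ℕ∞}

/-- Semicontinuity of the order makes `V_{k+1}` closed, so projecting onto it is possible; the
remainder stays in `V_k` because `V_{k+1} ⊆ V_k`. -/
theorem exists_component_add (hv : IsValuationHilbertModule ordR ordH) {V : Submodule ℂ H}
    (hV : IsClosed (V : Set H)) {k : ℕ} {x : H} (hx : x ∈ hv.subspaceSeries V k) :
    ∃ w ∈ hv.component V k, ∃ v ∈ hv.subspaceSeries V (k + 1), x = w + v := by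
  have := hv.complete
  have : CompleteSpace (hv.subspaceSeries V (k + 1)) :=
    (hv.isClosed_subspaceSeries V hV (k + 1)).completeSpace_coe
  obtain ⟨v, hv1, w, hw, rfl⟩ :=
    (hv.subspaceSeries V (k + 1)).exists_add_mem_mem_orthogonal x
  refine ⟨w, ⟨?_, hw⟩, v, hv1, add_comm _ _⟩
  have hvk : v ∈ hv.subspaceSeries V k :=
    ⟨hv1.1, le_trans (by exact_mod_cast Nat.le_succ k) hv1.2⟩
  simpa using (hv.subspaceSeries V k).sub_mem hx hvk

theorem proj_eq_zero_of_mem (hv : IsValuationHilbertModule ordR ordH) {k : ℕ} {x : H}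
    (hx : ((k + 1 : ℕ) : ℕ∞) ≤ ordH x) : hv.proj k x = 0 := by
  have := hv.hasOrthogonalProjection_component k
  refine ((hv.component ⊤ k).starProjection_apply_eq_zero_iff).2 ?_
  intro y hy
  rw [← inner_conj_symm, hy.2 x ⟨trivial, hx⟩, map_zero]

/-- `P_k` reads off the leading part: it is the identity on the first summand of `H_k = W_k ⊕
H_{k+1}` and kills the second. -/
theorem le_ord_of_proj_eq_zero (hv : IsValuationHilbertModule ordR ordH) {k : ℕ} {x : H}
    (hx : (k : ℕ∞) ≤ ordH x) (h0 : hv.proj k x = 0) : ((k + 1 : ℕ) : ℕ∞) ≤ ordH x := by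
  have := hv.hasOrthogonalProjection_component k
  obtain ⟨w, hw, v, hv', rfl⟩ := hv.exists_component_add (V := ⊤) isClosed_univ (x := x) (k := k)
    ⟨trivial, hx⟩
  rw [map_add, hv.proj_eq_zero_of_mem hv'.2, add_zero] at h0
  have hw0 : w = 0 := by
    rw [← h0]
    exact (Submodule.starProjection_eq_self_iff.2 hw).symm
  rw [hw0, zero_add]
  exact hv'.2

theorem eq_zero_of_forall_le_ord (hv : IsValuationHilbertModule ordR ordH) {x : H}
    (h : ∀ k : ℕ, (k : ℕ∞) ≤ ordH x) : x = 0 :=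
  (hv.moduleValuation.ord_eq_top_iff x).1 (ENat.eq_top_iff_forall_ge.2 h)

/-- Density of the span of the components in `V`, in dual form. Each splitting of `x` has zero
component, so the order of `x` keeps growing, and only `0` has infinite order. -/
theorem eq_zero_of_forall_mem_component_orthogonal (hv : IsValuationHilbertModule ordR ordH)
    {V : Submodule ℂ H} (hV : IsClosed (V : Set H)) {x : H} (hx : x ∈ V)
    (h : ∀ k, x ∈ (hv.component V k)ᗮ) : x = 0 := by
  refine hv.eq_zero_of_forall_le_ord fun k => ?_
  induction k with
  | zero => simp
  | succ k ih =>
    obtain ⟨w, hw, v, hv', hxe⟩ := hv.exists_component_add hV (x := x) (k := k) ⟨hx, ih⟩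
    have h1 : inner ℂ w x = 0 := h k w hw
    have h2 : inner ℂ w v = 0 := by
      rw [← inner_conj_symm, hw.2 v hv', map_zero]
    rw [hxe, inner_add_right, h2, add_zero, inner_self_eq_zero] at h1
    rw [hxe, h1, zero_add]
    exact hv'.2

theorem IsInvariantOne.isInner {hv : IsValuationHilbertModule ordR ordH} {V : Submodule ℂ H}
    (h1 : hv.IsInvariantOne V) : hv.IsInner V := by
  intro k m h hh g hg r hr hlt
  have hm : r • h - g ∈ hv.subspaceSeries V (m + 1) :=
    ⟨V.sub_mem (h1 r hr h hh.1.1) hg, by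
      have := Order.add_one_le_of_lt hlt
      exact_mod_cast this⟩
  intro w hw
  rw [← inner_conj_symm, hw.2 _ hm, map_zero]

theorem IsInvariantOne.hasFullProjection {hv : IsValuationHilbertModule ordR ordH}
    {V : Submodule ℂ H} (hV : IsClosed (V : Set H))
    (h1 : hv.IsInvariantOne V) : hv.HasFullProjection V := by
  intro k m r hr h hh g hg hle
  obtain ⟨w, hw, v, hv', he⟩ := hv.exists_component_add hV (x := r • h - g) (k := m)
    ⟨V.sub_mem (h1 r hr h hh.1.1) hg, hle⟩
  exact ⟨w, hw, by rw [he, map_add, hv.proj_eq_zero_of_mem hv'.2, add_zero]⟩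

theorem isInvariantOne_of_isInner (hv : IsValuationHilbertModule ordR ordH) {V : Submodule ℂ H}
    (hV : IsClosed (V : Set H)) (hin : hv.IsInner V) (hfp : hv.HasFullProjection V) :
    hv.IsInvariantOne V := by
  have := hv.complete
  have hVc : CompleteSpace V := hV.completeSpace_coe
  intro r hr
  have key : ∀ k, ∀ h ∈ hv.component V k, r • h ∈ V := by
    intro k h hh
    obtain ⟨g, hg, f, hf, hgf⟩ := V.exists_add_mem_mem_orthogonal (r • h)
    have hfe : r • h - g = f := by rw [hgf]; abel
    -- The residue `f` is orthogonal to `V`; its leading part of degree `m` is matched by some `w ∈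
    -- W_m`, which turns out to be zero.
    have hord : ∀ m : ℕ, (m : ℕ∞) ≤ ordH f := by
      intro m
      induction m with
      | zero => simp
      | succ m ih =>
        rw [← hfe] at ih
        obtain ⟨w, hw, hpw⟩ := hfp k m r hr h hh g hg ih
        rw [hfe] at ih hpw
        have hmem : f - w ∈ hv.subspaceSeries (⊤ : Submodule ℂ H) m :=
          Submodule.sub_mem _ ⟨trivial, ih⟩ ⟨trivial, hw.1.2⟩
        have hlt : ((m + 1 : ℕ) : ℕ∞) ≤ ordH (f - w) :=
          hv.le_ord_of_proj_eq_zero hmem.2 (by rw [map_sub, hpw, sub_self])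
        have he : r • h - (g + w) = f - w := by rw [hgf]; abel
        -- Innerness is applied with `g + w` in place of `g`, so that the difference is `f - w`, of
        -- order above `m`.
        have hperp := hin k m h hh (g + w) (V.add_mem hg hw.1.1) r hr (by
          rw [he]; exact lt_of_lt_of_le (by exact_mod_cast Nat.lt_succ_self m) hlt)
        rw [he] at hperp
        have h1 : inner ℂ w (f - w) = 0 := hperp w hw
        have h2 : inner ℂ w f = 0 := hf w hw.1.1
        rw [inner_sub_right, h2, zero_sub, neg_eq_zero, inner_self_eq_zero] at h1
        rwa [h1, sub_zero] at hlt
    rw [hgf, hv.eq_zero_of_forall_le_ord hord, add_zero]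
    exact hg
  let T : H →L[ℂ] H :=
    { toFun := fun h => r • h
      map_add' := smul_add r
      map_smul' := fun c h => by
        have h1 := hv.smul_assoc c 1 h
        have h2 := hv.smul_assoc c 1 (r • h)
        rw [one_smul] at h1 h2
        rw [RingHom.id_apply, ← h1, ← h2, smul_smul, smul_smul, mul_comm]
      cont := hv.continuous_smul r }
  -- The vectors of `V` that `r` keeps in `V`: a closed subspace containing every component, hence
  -- all of `V`.
  let S : Submodule ℂ H := V ⊓ V.comap (T : H →ₗ[ℂ] H)
  have hS : IsClosed (S : Set H) := hV.inter (hV.preimage T.continuous)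
  have hSc : CompleteSpace S := hS.completeSpace_coe
  intro h hh
  obtain ⟨s, hs, f, hf, hsf⟩ := S.exists_add_mem_mem_orthogonal h
  have hf0 : f = 0 := by
    refine hv.eq_zero_of_forall_mem_component_orthogonal hV (x := f) ?_ fun k w hw => ?_
    · have : f = h - s := by rw [hsf]; abel
      rw [this]
      exact V.sub_mem hh hs.1
    · exact hf w ⟨hw.1.1, key k w hw⟩
  rw [hf0, add_zero] at hsf
  rw [hsf]
  exact hs.2

/-- If `R = ℂ + R₁`, the closed invariant subspaces are described by their homogeneous
decompositions. -/
theorem beurlingDescription (hv : IsValuationHilbertModule ordR ordH)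
    (hR : ∀ r : R, ∃ c : ℂ, 1 ≤ ordR (r - algebraMap ℂ R c)) : hv.BeurlingDescription := by
  intro V hV
  have h1 : hv.IsInvariantOne V ↔ hv.IsInner V ∧ hv.HasFullProjection V :=
    ⟨fun h => ⟨h.isInner, h.hasFullProjection hV⟩,
      fun h => hv.isInvariantOne_of_isInner hV h.1 h.2⟩
  refine ⟨h1, ?_⟩
  rw [← h1]
  refine ⟨fun h r _ => h r, fun h r x hx => ?_⟩
  obtain ⟨c, hc⟩ := hR r
  have h2 := V.add_mem (h _ hc x hx) (V.smul_mem c hx)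
  have h3 := hv.smul_assoc c 1 x
  rw [one_smul] at h3
  rwa [sub_smul, Algebra.algebraMap_eq_smul_one, h3, sub_add_cancel] at h2

end IsValuationHilbertModule

end

/-! ### Multi-index power series and Cauchy estimates on a polydisk. -/

noncomputable section

theorem summable_prod_of_nonneg_of_summable {n : ℕ} (g : Fin n → ℕ → ℝ)
    (h0 : ∀ j k, 0 ≤ g j k) (hg : ∀ j, Summable (g j)) :
    Summable fun α : Fin n → ℕ => ∏ j, g j (α j) := by
  induction n with
  | zero => exact (hasSum_fintype _).summable
  | succ n ih =>
    rw [← (Fin.consEquiv fun _ : Fin (n + 1) => ℕ).summable_iff]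
    have h1 := (hg 0).mul_of_nonneg (ih (fun j => g j.succ) (fun j => h0 j.succ) fun j => hg j.succ)
      (fun k => h0 0 k) (fun α => Finset.prod_nonneg fun j _ => h0 _ _)
    refine h1.congr fun p => ?_
    simp [Fin.consEquiv, Fin.prod_univ_succ]

theorem summable_prod_pow {n : ℕ} {x : Fin n → ℝ} (h0 : ∀ j, 0 ≤ x j) (h1 : ∀ j, x j < 1) :
    Summable fun α : Fin n → ℕ => ∏ j, x j ^ α j :=
  summable_prod_of_nonneg_of_summable (fun j k => x j ^ k) (fun j k => pow_nonneg (h0 j) k)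
    fun j => summable_geometric_of_lt_one (h0 j) (h1 j)

theorem summable_pow_sum (n : ℕ) {q : ℝ} (h0 : 0 ≤ q) (h1 : q < 1) :
    Summable fun α : Fin n → ℕ => q ^ ∑ j, α j := by
  simpa [Finset.prod_pow_eq_pow_sum] using
    summable_prod_pow (n := n) (x := fun _ => q) (fun _ => h0) fun _ => h1

theorem norm_cons_lt_iff {n : ℕ} {ρ : ℝ} (hρ : 0 < ρ) (w : ℂ) (z : Fin n → ℂ) :
    ‖(Fin.cons w z : Fin (n + 1) → ℂ)‖ < ρ ↔ ‖w‖ < ρ ∧ ‖z‖ < ρ := by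
  rw [pi_norm_lt_iff hρ, pi_norm_lt_iff hρ, Fin.forall_fin_succ]
  simp

theorem norm_cons_le_iff {n : ℕ} {ρ : ℝ} (hρ : 0 ≤ ρ) (w : ℂ) (z : Fin n → ℂ) :
    ‖(Fin.cons w z : Fin (n + 1) → ℂ)‖ ≤ ρ ↔ ‖w‖ ≤ ρ ∧ ‖z‖ ≤ ρ := by
  rw [pi_norm_le_iff_of_nonneg hρ, pi_norm_le_iff_of_nonneg hρ, Fin.forall_fin_succ]
  simp

/-- The inclusion of the hyperplane where the first coordinate vanishes. -/
def consZeroCLM (n : ℕ) : (Fin n → ℂ) →L[ℂ] (Fin (n + 1) → ℂ) :=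
  ContinuousLinearMap.pi
    (Fin.cons 0 fun j => ContinuousLinearMap.proj (R := ℂ) (φ := fun _ : Fin n => ℂ) j)

theorem consZeroCLM_apply {n : ℕ} (z : Fin n → ℂ) :
    consZeroCLM n z = (Fin.cons 0 z : Fin (n + 1) → ℂ) := by
  funext j
  refine Fin.cases ?_ (fun j => ?_) j <;> simp [consZeroCLM]

/-- The partial derivative with respect to the first coordinate. -/
def partialDerivZero {n : ℕ} (f : (Fin (n + 1) → ℂ) → ℂ) : (Fin (n + 1) → ℂ) → ℂ :=
  fun z => fderiv ℂ f z (Pi.single 0 1)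

theorem AnalyticOnNhd.partialDerivZero_iterate {n : ℕ} {f : (Fin (n + 1) → ℂ) → ℂ}
    {U : Set (Fin (n + 1) → ℂ)} (hf : AnalyticOnNhd ℂ f U) (k : ℕ) :
    AnalyticOnNhd ℂ (partialDerivZero^[k] f) U := by
  induction k with
  | zero => exact hf
  | succ k ih =>
    rw [Function.iterate_succ_apply']
    exact (ContinuousLinearMap.apply ℂ ℂ (Pi.single 0 1 : Fin (n + 1) → ℂ)).comp_analyticOnNhd
      ih.fderiv

theorem hasDerivAt_cons_slice {n : ℕ} {f : (Fin (n + 1) → ℂ) → ℂ} {w : ℂ} {z : Fin n → ℂ}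
    (hf : DifferentiableAt ℂ f (Fin.cons w z)) :
    HasDerivAt (fun w => f (Fin.cons w z)) (partialDerivZero f (Fin.cons w z)) w := by
  have h1 : HasDerivAt (fun w : ℂ => (Fin.cons w z : Fin (n + 1) → ℂ)) (Pi.single 0 1) w := by
    rw [hasDerivAt_pi]
    intro j
    refine Fin.cases ?_ (fun j => ?_) j
    · simpa using hasDerivAt_id' w
    · simpa using hasDerivAt_const w (z j)
  exact hf.hasFDerivAt.comp_hasDerivAt w h1

/-- Shows that the Taylor coefficients in the first variable depend analytically on the others,
which drives the induction on `n`. -/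
theorem iteratedDeriv_cons_slice {n : ℕ} {ρ : ℝ} {f : (Fin (n + 1) → ℂ) → ℂ}
    (hf : AnalyticOnNhd ℂ f (Metric.ball 0 ρ)) {z : Fin n → ℂ} (hz : ‖z‖ < ρ) (k : ℕ) :
    ∀ w : ℂ, ‖w‖ < ρ →
      iteratedDeriv k (fun w => f (Fin.cons w z)) w = partialDerivZero^[k] f (Fin.cons w z) := by
  have hρ : 0 < ρ := (norm_nonneg z).trans_lt hz
  induction k with
  | zero => intro w _; simp
  | succ k ih =>
    intro w hw
    rw [iteratedDeriv_succ, Function.iterate_succ_apply']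
    have h1 : iteratedDeriv k (fun w => f (Fin.cons w z)) =ᶠ[𝓝 w]
        fun w => partialDerivZero^[k] f (Fin.cons w z) := by
      filter_upwards [(isOpen_lt continuous_norm continuous_const).mem_nhds hw] with v hv
      exact ih v hv
    rw [h1.deriv_eq]
    refine (hasDerivAt_cons_slice ?_).deriv
    refine (hf.partialDerivZero_iterate k _ ?_).differentiableAt
    rw [mem_ball_zero_iff, norm_cons_lt_iff hρ]
    exact ⟨hw, hz⟩

theorem summable_norm_mul_pow_of_le {n : ℕ} {c : (Fin n → ℕ) → ℂ} {s t M : ℝ} (ht : 0 ≤ t)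
    (hts : t < s) (hc : ∀ α, ‖c α‖ * s ^ (∑ j, α j) ≤ M) :
    Summable fun α => ‖c α‖ * t ^ (∑ j, α j) := by
  have hs : 0 < s := ht.trans_lt hts
  refine Summable.of_nonneg_of_le (fun α => by positivity) (fun α => ?_)
    ((summable_pow_sum n (q := t / s) (by positivity) ((div_lt_one hs).2 hts)).mul_left M)
  have h1 : t ^ (∑ j, α j) = s ^ (∑ j, α j) * (t / s) ^ (∑ j, α j) := by
    rw [← mul_pow]; congr 1; field_simp
  rw [h1, ← mul_assoc]
  exact mul_le_mul_of_nonneg_right (hc α) (by positivity)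

theorem norm_monomial_le {n : ℕ} {z : Fin n → ℂ} {t : ℝ} (hz : ‖z‖ ≤ t) (α : Fin n → ℕ) :
    ‖∏ j, z j ^ α j‖ ≤ t ^ (∑ j, α j) := by
  rw [norm_prod, ← Finset.prod_pow_eq_pow_sum]
  refine Finset.prod_le_prod (fun j _ => norm_nonneg _) fun j _ => ?_
  rw [norm_pow]
  exact pow_le_pow_left₀ (norm_nonneg _) ((norm_le_pi_norm z j).trans hz) _

theorem summable_norm_monomials {n : ℕ} {c : (Fin n → ℕ) → ℂ} {t : ℝ}
    (hc : Summable fun α => ‖c α‖ * t ^ (∑ j, α j)) {z : Fin n → ℂ} (hz : ‖z‖ ≤ t) :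
    Summable fun α => ‖c α * ∏ j, z j ^ α j‖ := by
  refine Summable.of_nonneg_of_le (fun α => norm_nonneg _) (fun α => ?_) hc
  rw [norm_mul]
  exact mul_le_mul_of_nonneg_left (norm_monomial_le hz α) (norm_nonneg _)

theorem exists_bound_of_analyticOnNhd_ball {n : ℕ} {ρ s : ℝ} {f : (Fin n → ℂ) → ℂ}
    (hf : AnalyticOnNhd ℂ f (Metric.ball 0 ρ)) (hs : s < ρ) :
    ∃ M, ∀ z, ‖z‖ ≤ s → ‖f z‖ ≤ M := by
  obtain ⟨M, hM⟩ := (isCompact_closedBall (0 : Fin n → ℂ) s).exists_bound_of_continuousOn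
    (hf.continuousOn.mono (Metric.closedBall_subset_ball hs))
  exact ⟨M, fun z hz => hM z (by simpa using hz)⟩

/-- The power series expansion of an analytic function on a polydisk, with Cauchy's estimates. -/
theorem exists_hasSum_monomials_and_cauchy_estimate {n : ℕ} {ρ : ℝ} (f : (Fin n → ℂ) → ℂ)
    (hf : AnalyticOnNhd ℂ f (Metric.ball 0 ρ)) :
    ∃ c : (Fin n → ℕ) → ℂ,
      (∀ s M : ℝ, 0 < s → s < ρ → (∀ z, ‖z‖ ≤ s → ‖f z‖ ≤ M) →
        ∀ α, ‖c α‖ * s ^ (∑ j, α j) ≤ M) ∧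
      ∀ z, ‖z‖ < ρ → HasSum (fun α => c α * ∏ j, z j ^ α j) (f z) := by
  induction n with
  | zero =>
    refine ⟨fun _ => f 0, fun s M hs _ hM α => ?_, fun z _ => ?_⟩
    · simpa using hM 0 (by rw [norm_zero]; exact hs.le)
    · rw [Subsingleton.elim z 0]
      simp
  | succ n ih =>
    -- `F k z` is the `k`-th Taylor coefficient of `w ↦ f (w, z)` at `0`; the induction hypothesis
    -- expands it in `z`.
    let F : ℕ → (Fin n → ℂ) → ℂ := fun k z =>
      (k.factorial : ℂ)⁻¹ * partialDerivZero^[k] f (Fin.cons 0 z)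
    have hF : ∀ k, AnalyticOnNhd ℂ (F k) (Metric.ball 0 ρ) := by
      intro k z hz
      have hz' : ‖z‖ < ρ := by simpa using hz
      have hρ : 0 < ρ := (norm_nonneg z).trans_lt hz'
      have h1 : AnalyticAt ℂ (partialDerivZero^[k] f) (consZeroCLM n z) := by
        refine hf.partialDerivZero_iterate k _ ?_
        rw [consZeroCLM_apply, mem_ball_zero_iff, norm_cons_lt_iff hρ]
        exact ⟨by simpa using hρ, hz'⟩
      have h2 := h1.comp ((consZeroCLM n).analyticAt z)
      have h3 : F k = fun z => (k.factorial : ℂ)⁻¹ * (partialDerivZero^[k] f ∘ consZeroCLM n) z := by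
        funext z
        simp [F, consZeroCLM_apply]
      rw [h3]
      exact analyticAt_const.mul h2
    have hslice : ∀ z : Fin n → ℂ, ‖z‖ < ρ →
        DifferentiableOn ℂ (fun w => f (Fin.cons w z)) (Metric.ball 0 ρ) := by
      intro z hz w hw
      have hρ : 0 < ρ := (norm_nonneg z).trans_lt hz
      refine (hasDerivAt_cons_slice (hf _ ?_).differentiableAt).differentiableAt.differentiableWithinAt
      rw [mem_ball_zero_iff, norm_cons_lt_iff hρ]
      exact ⟨by simpa using hw, hz⟩
    have hFeq : ∀ k z, ‖z‖ < ρ →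
        F k z = (k.factorial : ℂ)⁻¹ * iteratedDeriv k (fun w => f (Fin.cons w z)) 0 := by
      intro k z hz
      rw [iteratedDeriv_cons_slice hf hz k 0 (by simpa using (norm_nonneg z).trans_lt hz)]
    choose c hc1 hc2 using fun k => ih (F k) (hF k)
    have hbound : ∀ s M : ℝ, 0 < s → s < ρ → (∀ z, ‖z‖ ≤ s → ‖f z‖ ≤ M) →
        ∀ k β, ‖c k β‖ * (s ^ k * s ^ (∑ j, β j)) ≤ M := by
      intro s M hs hsρ hM k β
      -- The bound `M / s ^ k` for `F k` is the one-variable Cauchy estimate.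
      have h1 := hc1 k s (M / s ^ k) hs hsρ (fun z hz => by
        rw [hFeq k z (hz.trans_lt hsρ), norm_mul, norm_inv, Complex.norm_natCast]
        have h2 := Complex.norm_iteratedDeriv_le_of_forall_mem_sphere_norm_le k hs
          (f := fun w => f (Fin.cons w z)) (c := 0) (C := M)
          (((hslice z (hz.trans_lt hsρ)).mono
            (Metric.closedBall_subset_ball hsρ)).diffContOnCl_ball subset_rfl)
          (fun w hw => hM _ (by
            rw [norm_cons_le_iff hs.le]
            exact ⟨by simpa using hw.le, hz⟩))
        rw [inv_mul_le_iff₀ (by positivity)]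
        calc _ ≤ _ := h2
          _ = _ := by ring) β
      rw [le_div_iff₀ (by positivity)] at h1
      calc _ = _ := by ring
        _ ≤ M := h1
    refine ⟨fun α => c (α 0) (fun j => α j.succ), fun s M hs hsρ hM α => ?_, fun z hz => ?_⟩
    · rw [Fin.sum_univ_succ, pow_add]
      exact hbound s M hs hsρ hM _ _
    · have hρ : 0 < ρ := (norm_nonneg z).trans_lt hz
      obtain ⟨s, hzs, hsρ⟩ := exists_between hz
      have hs : 0 < s := (norm_nonneg z).trans_lt hzs
      obtain ⟨M, hM⟩ := exists_bound_of_analyticOnNhd_ball hf hsρ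
      -- Absolute convergence comes from the Cauchy estimates at an intermediate radius `s`; it
      -- legitimizes the rearrangement into an iterated sum.
      have hsum : Summable fun α : Fin (n + 1) → ℕ =>
          c (α 0) (fun j => α j.succ) * ∏ j, z j ^ α j := by
        refine Summable.of_norm (summable_norm_monomials (t := ‖z‖) ?_ le_rfl)
        refine summable_norm_mul_pow_of_le (norm_nonneg z) hzs (M := M) fun α => ?_
        rw [Fin.sum_univ_succ, pow_add]
        exact hbound s M hs hsρ hM _ _
      have hz1 : ‖z 0‖ < ρ := (norm_le_pi_norm z 0).trans_lt hz
      have hz2 : ‖(fun j => z (Fin.succ j) : Fin n → ℂ)‖ < ρ :=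
        (pi_norm_lt_iff hρ).2 fun j => (norm_le_pi_norm z j.succ).trans_lt hz
      have htay := Complex.hasSum_taylorSeries_on_ball (hslice _ hz2)
        (z := z 0) (by simpa using hz1)
      have hcons : (Fin.cons (z 0) (fun j => z (Fin.succ j)) : Fin (n + 1) → ℂ) = z :=
        Fin.cons_self_tail z
      simp only [hcons] at htay
      have hsum' := (Fin.consEquiv fun _ : Fin (n + 1) => ℕ).summable_iff.2 hsum
      have hfib : ∀ k : ℕ, HasSum (fun β : Fin n → ℕ =>
          ((fun α : Fin (n + 1) → ℕ => c (α 0) (fun j => α j.succ) * ∏ j, z j ^ α j) ∘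
            (Fin.consEquiv fun _ : Fin (n + 1) => ℕ)) (k, β))
          ((k.factorial : ℂ)⁻¹ • (z 0 - 0) ^ k •
            iteratedDeriv k (fun w => f (Fin.cons w fun j => z (Fin.succ j))) 0) := by
        intro k
        have h1 := (hc2 k _ hz2).mul_left (z 0 ^ k)
        rw [hFeq k _ hz2] at h1
        have h3 : (k.factorial : ℂ)⁻¹ • (z 0 - 0) ^ k •
            iteratedDeriv k (fun w => f (Fin.cons w fun j => z (Fin.succ j))) 0 =
            z 0 ^ k * ((k.factorial : ℂ)⁻¹ *
              iteratedDeriv k (fun w => f (Fin.cons w fun j => z (Fin.succ j))) 0) := by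
          rw [smul_eq_mul, smul_eq_mul, sub_zero]
          ring
        rw [h3]
        refine Eq.mpr (congrArg (fun g => HasSum g _) (funext fun β => ?_)) h1
        simp only [Function.comp_apply, Fin.consEquiv, Equiv.coe_fn_mk, Fin.prod_univ_succ,
          Fin.cons_zero, Fin.cons_succ]
        ring
      have h4 := hsum'.hasSum.prod_fiberwise hfib
      have h5 := h4.unique htay
      rw [← h5]
      exact (Fin.consEquiv fun _ : Fin (n + 1) => ℕ).hasSum_iff.1 hsum'.hasSum

end

/-! ### From multi-index series to formal multilinear series. -/

noncomputable section

/-- The form multiplies one coordinate of each argument, coordinate `j` being used in `α j` slots;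
coordinates have norm at most one for the sup norm. -/
theorem exists_multilinear_monomial {n : ℕ} {k : ℕ} {α : Fin n → ℕ} (hα : ∑ j, α j = k) :
    ∃ m : ContinuousMultilinearMap ℂ (fun _ : Fin k => Fin n → ℂ) ℂ,
      ‖m‖ ≤ 1 ∧ ∀ y : Fin n → ℂ, m (fun _ => y) = ∏ j, y j ^ α j := by
  subst hα
  let σ : Fin (∑ j, α j) → Fin n := fun i => (finSigmaFinEquiv.symm i).1
  refine ⟨(ContinuousMultilinearMap.mkPiAlgebra ℂ (Fin (∑ j, α j)) ℂ).compContinuousLinearMap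
    fun i => ContinuousLinearMap.proj (R := ℂ) (φ := fun _ : Fin n => ℂ) (σ i), ?_, fun y => ?_⟩
  · refine (ContinuousMultilinearMap.norm_compContinuousLinearMap_le _ _).trans ?_
    rw [ContinuousMultilinearMap.norm_mkPiAlgebra, one_mul]
    refine Finset.prod_le_one (fun _ _ => norm_nonneg _) fun i _ => ?_
    refine ContinuousLinearMap.opNorm_le_bound _ zero_le_one fun y => ?_
    rw [one_mul]
    exact norm_le_pi_norm y (σ i)
  · simp only [ContinuousMultilinearMap.compContinuousLinearMap_apply,
      ContinuousLinearMap.proj_apply, ContinuousMultilinearMap.mkPiAlgebra_apply]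
    rw [← finSigmaFinEquiv.prod_comp, Fintype.prod_sigma]
    simp [σ]

theorem mem_piAntidiag_univ {n k : ℕ} {α : Fin n → ℕ} :
    α ∈ (Finset.univ : Finset (Fin n)).piAntidiag k ↔ ∑ j, α j = k := by
  simp [Finset.mem_piAntidiag]

theorem HasSum.sum_piAntidiag {n : ℕ} {E : Type*} [AddCommGroup E] [TopologicalSpace E]
    [IsTopologicalAddGroup E] [RegularSpace E] {g : (Fin n → ℕ) → E} {s : E} (h : HasSum g s) :
    HasSum (fun k => ∑ α ∈ (Finset.univ : Finset (Fin n)).piAntidiag k, g α) s := by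
  refine ((Equiv.sigmaFiberEquiv fun α : Fin n → ℕ => ∑ j, α j).hasSum_iff.2 h).sigma fun k => ?_
  have h1 : HasSum (g ∘ ((↑) : {α : Fin n → ℕ | ∑ j, α j = k} → Fin n → ℕ))
      (∑ α ∈ (Finset.univ : Finset (Fin n)).piAntidiag k, g α) := by
    rw [hasSum_subtype_iff_indicator]
    have h2 := hasSum_sum_of_ne_finset_zero (f := indicator {α : Fin n → ℕ | ∑ j, α j = k} g)
      (s := (Finset.univ : Finset (Fin n)).piAntidiag k) (L := .unconditional _) fun α hα =>
        indicator_of_notMem (s := {α : Fin n → ℕ | ∑ j, α j = k})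
          (fun hm => hα (mem_piAntidiag_univ.2 hm)) g
    rwa [Finset.sum_congr rfl fun α hα =>
      indicator_of_mem (s := {α : Fin n → ℕ | ∑ j, α j = k}) (mem_piAntidiag_univ.1 hα) g] at h2
  exact h1

/-- Grouping by total degree links the coefficients `c α` to the power series in which `zeroOrder`
is defined. The polydisk is a ball of the sup norm. -/
theorem exists_hasFPowerSeriesOnBall_monomials {n : ℕ} {ρ : ℝ} (hρ : 0 < ρ)
    {c : (Fin n → ℕ) → ℂ} (hc : ∀ t, 0 ≤ t → t < ρ → Summable fun α => ‖c α‖ * t ^ (∑ j, α j))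
    {f : (Fin n → ℂ) → ℂ} (hf : ∀ z, ‖z‖ < ρ → HasSum (fun α => c α * ∏ j, z j ^ α j) (f z)) :
    ∃ p : FormalMultilinearSeries ℂ (Fin n → ℂ) ℂ,
      HasFPowerSeriesOnBall f p 0 (ENNReal.ofReal ρ) ∧ ∀ k y, p k (fun _ => y) =
        ∑ α ∈ (Finset.univ : Finset (Fin n)).piAntidiag k, c α * ∏ j, y j ^ α j := by
  choose m hm1 hm2 using fun (k : ℕ) (α : {α : Fin n → ℕ // ∑ j, α j = k}) =>
    exists_multilinear_monomial α.2
  let p : FormalMultilinearSeries ℂ (Fin n → ℂ) ℂ := fun k =>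
    ∑ α ∈ ((Finset.univ : Finset (Fin n)).piAntidiag k).attach,
      c α.1 • m k ⟨α.1, mem_piAntidiag_univ.1 α.2⟩
  have hp : ∀ k y, p k (fun _ => y) =
        ∑ α ∈ (Finset.univ : Finset (Fin n)).piAntidiag k, c α * ∏ j, y j ^ α j := by
    intro k y
    rw [← Finset.sum_attach]
    simp [p, hm2]
  have hpn : ∀ k, ‖p k‖ ≤ ∑ α ∈ (Finset.univ : Finset (Fin n)).piAntidiag k, ‖c α‖ := by
    intro k
    rw [← Finset.sum_attach]
    refine (norm_sum_le _ _).trans (Finset.sum_le_sum fun α _ => ?_)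
    rw [norm_smul]
    exact mul_le_of_le_one_right (norm_nonneg _) (hm1 _ _)
  refine ⟨p, ⟨?_, by simpa using hρ, fun {y} hy => ?_⟩, hp⟩
  · refine le_of_forall_lt fun r hr => ?_
    obtain ⟨t, hrt, htρ⟩ := exists_between hr
    lift t to NNReal using ne_top_of_lt htρ
    have htρ' : (t : ℝ) < ρ := by
      rwa [ENNReal.ofReal, ENNReal.coe_lt_coe, Real.lt_toNNReal_iff_coe_lt] at htρ
    refine hrt.trans_le (p.le_radius_of_summable_norm ?_)
    refine Summable.of_nonneg_of_le (fun k => by positivity) (fun k => ?_)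
      (hc t t.2 htρ').hasSum.sum_piAntidiag.summable
    refine (mul_le_mul_of_nonneg_right (hpn k) (by positivity)).trans (le_of_eq ?_)
    rw [Finset.sum_mul]
    refine Finset.sum_congr rfl fun α hα => ?_
    rw [mem_piAntidiag_univ.1 hα]
  · have hy' : ‖y‖ < ρ := by
      have : y ∈ Metric.ball (0 : Fin n → ℂ) ρ := by rwa [← Metric.eball_ofReal]
      simpa using this
    rw [zero_add]
    refine Eq.mpr (congrArg (fun g => HasSum g _) (funext fun k => hp k y)) ?_
    exact (hf y hy').sum_piAntidiag

theorem coeff_eq_zero_of_sum_monomials_eq_zero {n : ℕ} {c : (Fin n → ℕ) → ℂ}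
    {S : Finset (Fin n → ℕ)} (h : ∀ y : Fin n → ℂ, ∑ α ∈ S, c α * ∏ j, y j ^ α j = 0) :
    ∀ α ∈ S, c α = 0 := by
  let P : MvPolynomial (Fin n) ℂ :=
    ∑ α ∈ S, MvPolynomial.monomial (Finsupp.equivFunOnFinite.symm α) (c α)
  have hP : P = 0 := by
    refine MvPolynomial.funext fun y => ?_
    rw [map_zero, ← h y, map_sum]
    refine Finset.sum_congr rfl fun α _ => ?_
    rw [MvPolynomial.eval_monomial, Finsupp.prod_fintype _ _ (by simp)]
    simp
  intro α hα
  have h1 : P.coeff (Finsupp.equivFunOnFinite.symm α) = c α := by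
    rw [MvPolynomial.coeff_sum, Finset.sum_eq_single α]
    · simp
    · intro β _ hβ
      rw [MvPolynomial.coeff_monomial, if_neg]
      exact fun h => hβ (Finsupp.equivFunOnFinite.symm.injective h)
    · exact fun h => absurd hα h
  rw [← h1, hP, MvPolynomial.coeff_zero]

theorem coeff_eq_zero_of_hasSum_zero {n : ℕ} {ρ : ℝ} (hρ : 0 < ρ) {c : (Fin n → ℕ) → ℂ}
    (hc : ∀ t, 0 ≤ t → t < ρ → Summable fun α => ‖c α‖ * t ^ (∑ j, α j))
    (hf : ∀ z : Fin n → ℂ, ‖z‖ < ρ → HasSum (fun α => c α * ∏ j, z j ^ α j) 0) : c = 0 := by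
  obtain ⟨p, hp, hpc⟩ := exists_hasFPowerSeriesOnBall_monomials hρ hc (f := 0) hf
  funext α
  refine coeff_eq_zero_of_sum_monomials_eq_zero
    (S := (Finset.univ : Finset (Fin n)).piAntidiag (∑ j, α j)) (fun y => ?_) α
    (mem_piAntidiag_univ.2 rfl)
  rw [← hpc]
  exact hp.hasFPowerSeriesAt.apply_eq_zero _ _

/-! ### The order of a zero as a valuation. -/

section Order

variable {n : ℕ} {Ω : Set (Fin n → ℂ)} {a : Fin n → ℂ}

/-- The definition allows a different series for each degree. The multilinear terms need not be
unique, but their diagonal values are, so one series suffices. -/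
theorem le_zeroOrder_iff {f : Ω → ℂ} {p : FormalMultilinearSeries ℂ (Fin n → ℂ) ℂ}
    (hp : HasFPowerSeriesAt (zeroExt f) p a) (k : ℕ) :
    (k : ℕ∞) ≤ zeroOrder a f ↔ ∀ j < k, ∀ y, p j (fun _ => y) = 0 := by
  unfold zeroOrder
  rw [le_iInf₂_iff]
  constructor
  · intro h j hj y
    by_contra hne
    have := h j ⟨p, hp, y, hne⟩
    exact absurd hj (not_lt.2 (by exact_mod_cast this))
  · rintro h j ⟨q, hq, z, hne⟩
    rw [Nat.cast_le]
    by_contra hlt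
    push Not at hlt
    have h1 := hq.sub hp
    rw [sub_self] at h1
    have h2 := h1.apply_eq_zero j z
    rw [FormalMultilinearSeries.sub_apply, sub_apply, h j hlt z,
      sub_zero] at h2
    exact hne h2

/-- In this growth form the valuation rules become rules for `O`. For the converse, once the terms
below degree `j < k` vanish, the term of degree `j` is `O(‖y‖ ^ (j + 1))`, hence zero. -/
theorem le_zeroOrder_iff_isBigO {f : Ω → ℂ} (hf : AnalyticAt ℂ (zeroExt f) a) (k : ℕ) :
    (k : ℕ∞) ≤ zeroOrder a f ↔
      (fun y => zeroExt f (a + y)) =O[𝓝 0] fun y : Fin n → ℂ => ‖y‖ ^ k := by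
  obtain ⟨p, hp⟩ := hf
  rw [le_zeroOrder_iff hp]
  constructor
  · intro h
    have h1 := hp.isBigO_sub_partialSum_pow k
    have h2 : ∀ y, p.partialSum k y = 0 := fun y =>
      Finset.sum_eq_zero fun j hj => h j (Finset.mem_range.1 hj) y
    simpa only [h2, sub_zero] using h1
  · intro h j
    induction j using Nat.strong_induction_on with
    | _ j ih =>
      intro hj
      have h1 := hp.isBigO_sub_partialSum_pow (j + 1)
      have h2 : ∀ y, p.partialSum (j + 1) y = p j fun _ => y := by
        intro y
        rw [FormalMultilinearSeries.partialSum, Finset.sum_range_succ,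
          Finset.sum_eq_zero, zero_add]
        intro i hi
        have hi' := Finset.mem_range.1 hi
        exact ih i hi' (hi'.trans hj) y
      have h3 : (fun y : Fin n → ℂ => ‖y‖ ^ k) =O[𝓝 0] fun y => ‖y‖ ^ (j + 1) := by
        refine Asymptotics.IsBigO.of_bound 1 ?_
        filter_upwards [Metric.ball_mem_nhds (0 : Fin n → ℂ) one_pos] with y hy
        rw [one_mul, norm_pow, norm_pow, norm_norm]
        exact pow_le_pow_of_le_one (norm_nonneg _) (mem_ball_zero_iff.1 hy).le hj
      refine Asymptotics.IsBigO.continuousMultilinearMap_apply_eq_zero ?_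
      have h4 := (h.trans h3).sub h1
      simpa only [h2, sub_sub_cancel] using h4

theorem zeroOrder_add_le_mul {f g : Ω → ℂ} (hf : AnalyticAt ℂ (zeroExt f) a)
    (hg : AnalyticAt ℂ (zeroExt g) a) : zeroOrder a f + zeroOrder a g ≤ zeroOrder a (f * g) := by
  have hfg : AnalyticAt ℂ (zeroExt (f * g)) a := by rw [zeroExt_mul]; exact hf.mul hg
  have key : ∀ i j : ℕ, (i : ℕ∞) ≤ zeroOrder a f → (j : ℕ∞) ≤ zeroOrder a g →
      ((i + j : ℕ) : ℕ∞) ≤ zeroOrder a (f * g) := by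
    intro i j hi hj
    rw [le_zeroOrder_iff_isBigO hf] at hi
    rw [le_zeroOrder_iff_isBigO hg] at hj
    rw [le_zeroOrder_iff_isBigO hfg, zeroExt_mul]
    simp only [pow_add]
    exact hi.mul hj
  rcases eq_or_ne (zeroOrder a f) ⊤ with h1 | h1
  · refine le_of_le_of_eq le_top (Eq.symm (ENat.eq_top_iff_forall_ge.2 fun k => ?_))
    simpa using key k 0 (by simp [h1]) (by simp)
  rcases eq_or_ne (zeroOrder a g) ⊤ with h2 | h2
  · refine le_of_le_of_eq le_top (Eq.symm (ENat.eq_top_iff_forall_ge.2 fun k => ?_))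
    simpa using key 0 k (by simp) (by simp [h2])
  obtain ⟨i, hi⟩ := ENat.ne_top_iff_exists.1 h1
  obtain ⟨j, hj⟩ := ENat.ne_top_iff_exists.1 h2
  rw [← hi, ← hj]
  exact_mod_cast key i j hi.le hj.le

theorem min_zeroOrder_le_add {f g : Ω → ℂ} (hf : AnalyticAt ℂ (zeroExt f) a)
    (hg : AnalyticAt ℂ (zeroExt g) a) :
    min (zeroOrder a f) (zeroOrder a g) ≤ zeroOrder a (f + g) := by
  have hfg : AnalyticAt ℂ (zeroExt (f + g)) a := by rw [zeroExt_add]; exact hf.add hg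
  rw [← ENat.forall_natCast_le_iff_le]
  intro k hk
  rw [le_min_iff, le_zeroOrder_iff_isBigO hf, le_zeroOrder_iff_isBigO hg] at hk
  rw [le_zeroOrder_iff_isBigO hfg, zeroExt_add]
  exact hk.1.add hk.2

theorem zeroOrder_smul {f : Ω → ℂ} (hf : AnalyticAt ℂ (zeroExt f) a) {c : ℂ} (hc : c ≠ 0) :
    zeroOrder a (c • f) = zeroOrder a f := by
  have hcf : AnalyticAt ℂ (zeroExt (c • f)) a := by
    rw [zeroExt_smul]; exact analyticAt_const.smul hf
  refine le_antisymm ?_ ?_ <;> rw [← ENat.forall_natCast_le_iff_le] <;> intro k hk <;>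
    rw [le_zeroOrder_iff_isBigO ‹_›] at hk ⊢ <;> rw [zeroExt_smul] at * <;>
    simpa [Asymptotics.isBigO_const_mul_left_iff hc] using hk

theorem one_le_zeroOrder_iff {f : Ω → ℂ} (hf : AnalyticAt ℂ (zeroExt f) a) :
    1 ≤ zeroOrder a f ↔ zeroExt f a = 0 := by
  obtain ⟨p, hp⟩ := hf
  have h := le_zeroOrder_iff hp 1
  rw [Nat.cast_one] at h
  rw [h, ← hp.coeff_zero 0]
  constructor
  · intro h1
    rw [← h1 0 one_pos 0]
    congr 1
  · intro h1 j hj y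
    obtain rfl : j = 0 := by omega
    rw [← h1]
    congr 1
    exact Subsingleton.elim _ _

theorem zeroOrder_eq_top_iff (hΩ : IsPreconnected Ω) (ha : a ∈ Ω) {f : Ω → ℂ}
    (hf : IsAnalyticFun f) : zeroOrder a f = ⊤ ↔ f = 0 := by
  obtain ⟨p, hp⟩ := hf a ha
  rw [ENat.eq_top_iff_forall_ge]
  simp only [le_zeroOrder_iff hp]
  constructor
  · intro h
    have h1 : zeroExt f =ᶠ[𝓝 a] 0 := by
      filter_upwards [hp.eventually_hasSum_sub] with y hy
      refine hy.unique ?_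
      simp only [h _ _ (Nat.lt_succ_self _)]
      exact hasSum_zero
    funext z
    rw [← zeroExt_apply f z.2]
    exact AnalyticOnNhd.eqOn_zero_of_preconnected_of_eventuallyEq_zero hf hΩ ha h1 z.2
  · rintro rfl k j - y
    have h0 : zeroExt (0 : Ω → ℂ) = 0 := by
      funext x
      simp [zeroExt, Function.extend]
    rw [h0] at hp
    exact hp.apply_eq_zero j y

end Order

end

/-! ### Separately harmonic functions and the minimum principle. -/

noncomputable section

theorem mem_polydisk_iff_norm_sub_lt {n : ℕ} {a z : Fin n → ℂ} {ρ : ℝ} (hρ : 0 < ρ) :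
    z ∈ polydisk a ρ ↔ ‖z - a‖ < ρ := by
  rw [pi_norm_lt_iff hρ]; rfl

theorem polydisk_eq_ball {n : ℕ} (a : Fin n → ℂ) {ρ : ℝ} (hρ : 0 < ρ) :
    polydisk a ρ = Metric.ball a ρ := by
  ext z
  rw [mem_polydisk_iff_norm_sub_lt hρ, mem_ball_iff_norm]

theorem update_mem_polydisk {n : ℕ} {a z : Fin n → ℂ} {ρ : ℝ} (hz : z ∈ polydisk a ρ) {j : Fin n}
    {w : ℂ} (hw : ‖w - a j‖ < ρ) : Function.update z j w ∈ polydisk a ρ := by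
  intro i
  rcases eq_or_ne i j with rfl | hij
  · simpa using hw
  · rw [Function.update_of_ne hij]; exact hz i

/-- A real harmonic function on a disk that is nonnegative on a circle is nonnegative inside. -/
theorem InnerProductSpace.HarmonicOnNhd.nonneg_of_nonneg_on_sphere {φ : ℂ → ℝ} {c : ℂ} {s ρ : ℝ}
    (hφ : InnerProductSpace.HarmonicOnNhd φ (Metric.ball c ρ)) (hs : 0 < s) (hsρ : s < ρ)
    (h0 : ∀ w, ‖w - c‖ = s → 0 ≤ φ w) {w : ℂ} (hw : ‖w - c‖ ≤ s) : 0 ≤ φ w := by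
  -- With `φ = Re F`, the claim is the maximum modulus principle for `exp (-F)`, whose modulus is
  -- `exp (-φ)`.
  obtain ⟨F, hF, hFφ⟩ := hφ.exists_analyticOnNhd_ball_re_eq
  have hnorm : ∀ v, ‖v - c‖ ≤ s → ‖Complex.exp (-F v)‖ = Real.exp (-φ v) := by
    intro v hv
    rw [Complex.norm_exp, Complex.neg_re, ← hFφ (mem_ball_iff_norm.2 (hv.trans_lt hsρ))]
  have hd : DiffContOnCl ℂ (fun v => Complex.exp (-F v)) (Metric.ball c s) :=
    ((hF.differentiableOn.mono (Metric.closedBall_subset_ball hsρ)).neg.cexp).diffContOnCl_ball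
      subset_rfl
  have h1 := Complex.norm_le_of_forall_mem_frontier_norm_le Metric.isBounded_ball hd (C := 1)
    (fun v hv => by
      rw [frontier_ball c hs.ne', mem_sphere_iff_norm] at hv
      rw [hnorm v hv.le, Real.exp_le_one_iff]
      exact neg_nonpos.2 (h0 v hv)) (z := w)
    (by rw [closure_ball c hs.ne']; exact mem_closedBall_iff_norm.2 hw)
  rw [hnorm w hw, Real.exp_le_one_iff] at h1
  exact neg_nonpos.1 h1

/-- Harmonicity in each variable separately on the polydisk. -/
def IsSeparatelyHarmonic {n : ℕ} (a : Fin n → ℂ) (ρ : ℝ) (V : (Fin n → ℂ) → ℝ) : Prop :=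
  ∀ z ∈ polydisk a ρ, ∀ j : Fin n,
    InnerProductSpace.HarmonicOnNhd (fun w : ℂ => V (Function.update z j w)) {w | ‖w - a j‖ < ρ}

namespace IsSeparatelyHarmonic

variable {n : ℕ} {a : Fin n → ℂ} {ρ : ℝ} {V W : (Fin n → ℂ) → ℝ}

theorem sub (hV : IsSeparatelyHarmonic a ρ V) (hW : IsSeparatelyHarmonic a ρ W) :
    IsSeparatelyHarmonic a ρ (V - W) := fun z hz j => (hV z hz j).sub (hW z hz j)

theorem congr (hV : IsSeparatelyHarmonic a ρ V) (h : EqOn V W (polydisk a ρ)) :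
    IsSeparatelyHarmonic a ρ W := by
  intro z hz j w hw
  refine (InnerProductSpace.harmonicAt_congr_nhds ?_).1 (hV z hz j w hw)
  have hopen : IsOpen {w : ℂ | ‖w - a j‖ < ρ} := isOpen_lt (by fun_prop) continuous_const
  filter_upwards [hopen.mem_nhds hw] with v hv
  exact h (update_mem_polydisk hz hv)

/-- The minimum principle on polydisks. -/
theorem nonneg_of_nonneg_on_torus (hV : IsSeparatelyHarmonic a ρ V) {s : ℝ} (hs : 0 < s)
    (hsρ : s < ρ) (h0 : ∀ z, (∀ j, ‖z j - a j‖ = s) → 0 ≤ V z) {z : Fin n → ℂ}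
    (hz : ∀ j, ‖z j - a j‖ ≤ s) : 0 ≤ V z := by
  -- `S` is the set of coordinates allowed to leave the circle; each new one costs one use of the
  -- one-variable principle.
  have key : ∀ S : Finset (Fin n), ∀ z : Fin n → ℂ, (∀ j, ‖z j - a j‖ ≤ s) →
      (∀ j ∉ S, ‖z j - a j‖ = s) → 0 ≤ V z := by
    intro S
    induction S using Finset.induction_on with
    | empty => exact fun z _ h => h0 z fun j => h j (Finset.notMem_empty j)
    | insert i S hi ih =>
      intro z hz hzS
      have h1 := hV z (fun j => (hz j).trans_lt hsρ) i
      have h2 : {w : ℂ | ‖w - a i‖ < ρ} = Metric.ball (a i) ρ := by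
        ext w; rw [mem_ball_iff_norm]; rfl
      rw [h2] at h1
      have h3 := h1.nonneg_of_nonneg_on_sphere hs hsρ (fun w hw => ?_) (hz i)
      · simpa using h3
      · refine ih _ (fun j => ?_) fun j hj => ?_
        · rcases eq_or_ne j i with rfl | hji
          · simpa using hw.le
          · rw [Function.update_of_ne hji]; exact hz j
        · rcases eq_or_ne j i with rfl | hji
          · simpa using hw
          · rw [Function.update_of_ne hji]
            exact hzS j (by simp [hji, hj])
  exact key Finset.univ z hz fun j hj => absurd (Finset.mem_univ j) hj

theorem le_of_le_on_torus (hV : IsSeparatelyHarmonic a ρ V) (hW : IsSeparatelyHarmonic a ρ W)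
    {s : ℝ} (hs : 0 < s) (hsρ : s < ρ) (h0 : ∀ z, (∀ j, ‖z j - a j‖ = s) → V z ≤ W z)
    {z : Fin n → ℂ} (hz : ∀ j, ‖z j - a j‖ ≤ s) : V z ≤ W z :=
  sub_nonneg.1 ((hW.sub hV).nonneg_of_nonneg_on_torus hs hsρ
    (fun z hz => sub_nonneg.2 (h0 z hz)) hz)

end IsSeparatelyHarmonic

theorem isSeparatelyHarmonic_re {n : ℕ} {a : Fin n → ℂ} {ρ : ℝ} {f : (Fin n → ℂ) → ℂ}
    (hf : AnalyticOnNhd ℂ f (polydisk a ρ)) :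
    IsSeparatelyHarmonic a ρ fun z => (f z).re := by
  intro z hz j w hw
  have h1 : AnalyticAt ℂ (fun w : ℂ => Function.update z j w) w := by
    rw [analyticAt_pi_iff]
    intro i
    rcases eq_or_ne i j with rfl | hij
    · simp only [Function.update_self]
      exact analyticAt_id
    · simpa [Function.update_of_ne hij] using analyticAt_const
  exact AnalyticAt.harmonicAt_re
    (AnalyticAt.fun_comp (f := fun w : ℂ => Function.update z j w) (hf _ (update_mem_polydisk hz hw)) h1)

end

/-! ### The Poisson extension of `|f|²` as a double series. -/

noncomputable section

variable {n : ℕ}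

/-- The polynomial in `z` and `conj z`, harmonic in each variable, that agrees with
`z ^ α * conj (z ^ β)` on the torus of radius `s`. -/
def mixedMonomial (s : ℝ) (α β : Fin n → ℕ) (x : Fin n → ℂ) : ℂ :=
  ∏ j, ((s : ℂ) ^ (2 * min (α j) (β j)) *
    (x j ^ (α j - β j) * (starRingEnd ℂ (x j)) ^ (β j - α j)))

/-- The maximum of `mixedMonomial s α β` on the polydisk of radius `t`. -/
def mixedBound (s t : ℝ) (α β : Fin n → ℕ) : ℝ :=
  ∏ j, (s ^ (2 * min (α j) (β j)) * t ^ ((α j - β j) + (β j - α j)))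

theorem mixedBound_nonneg {s t : ℝ} (hs : 0 ≤ s) (ht : 0 ≤ t) (α β : Fin n → ℕ) :
    0 ≤ mixedBound s t α β := Finset.prod_nonneg fun _ _ => by positivity

theorem mixedBound_mono {s s' t t' : ℝ} (hs : 0 ≤ s) (hss : s ≤ s') (ht : 0 ≤ t) (htt : t ≤ t')
    (α β : Fin n → ℕ) : mixedBound s t α β ≤ mixedBound s' t' α β := by
  have hs' := hs.trans hss
  refine Finset.prod_le_prod (fun _ _ => by positivity) fun _ _ => ?_
  gcongr

theorem norm_mixedMonomial_le {s t : ℝ} (hs : 0 ≤ s) {x : Fin n → ℂ} (hx : ∀ j, ‖x j‖ ≤ t)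
    (α β : Fin n → ℕ) : ‖mixedMonomial s α β x‖ ≤ mixedBound s t α β := by
  rw [mixedMonomial, mixedBound, norm_prod]
  refine Finset.prod_le_prod (fun _ _ => norm_nonneg _) fun j _ => ?_
  rw [norm_mul, norm_mul, norm_pow, norm_pow, norm_pow, RCLike.norm_conj, ← pow_add,
    Complex.norm_real, Real.norm_of_nonneg hs]
  gcongr
  exact hx j

theorem two_mul_min_add_sub (a b : ℕ) : 2 * min a b + ((a - b) + (b - a)) = a + b := by omega

theorem mixedBound_self (t : ℝ) (α β : Fin n → ℕ) :
    mixedBound t t α β = t ^ (∑ j, α j) * t ^ (∑ j, β j) := by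
  simp only [mixedBound, ← pow_add, two_mul_min_add_sub, Finset.prod_pow_eq_pow_sum,
    Finset.sum_add_distrib]

theorem mixedMonomial_of_mem_torus {s : ℝ} {x : Fin n → ℂ} (hx : ∀ j, ‖x j‖ = s)
    (α β : Fin n → ℕ) :
    mixedMonomial s α β x = (∏ j, x j ^ α j) * starRingEnd ℂ (∏ j, x j ^ β j) := by
  rw [map_prod, ← Finset.prod_mul_distrib]
  refine Finset.prod_congr rfl fun j _ => ?_
  have h1 : (s : ℂ) ^ 2 = x j * starRingEnd ℂ (x j) := by
    rw [Complex.mul_conj, Complex.normSq_eq_norm_sq, hx j, Complex.ofReal_pow]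
  rw [pow_mul, h1, map_pow, mul_pow]
  have h2 : min (α j) (β j) + (α j - β j) = α j := by omega
  have h3 : min (α j) (β j) + (β j - α j) = β j := by omega
  calc _ = x j ^ (min (α j) (β j) + (α j - β j)) *
        starRingEnd ℂ (x j) ^ (min (α j) (β j) + (β j - α j)) := by
          rw [pow_add, pow_add]; ring
    _ = _ := by rw [h2, h3]

theorem mixedMonomial_zero (s : ℝ) (α β : Fin n → ℕ) :
    mixedMonomial s α β 0 = if α = β then (s : ℂ) ^ (2 * ∑ j, α j) else 0 := by
  split_ifs with h
  · subst h
    simp [mixedMonomial, Finset.prod_pow_eq_pow_sum, Finset.mul_sum]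
  · obtain ⟨j, hj⟩ := Function.ne_iff.1 h
    refine Finset.prod_eq_zero (Finset.mem_univ j) ?_
    rcases lt_or_gt_of_ne hj with h1 | h1
    · have : β j - α j ≠ 0 := by omega
      simp [this]
    · have : α j - β j ≠ 0 := by omega
      simp [this]

/-- The Poisson extension from the torus of radius `s` of `|f|²`, where `f` is the function with
power series coefficients `c`. -/
def poissonSq (c : (Fin n → ℕ) → ℂ) (s : ℝ) (x : Fin n → ℂ) : ℝ :=
  ∑' p : (Fin n → ℕ) × (Fin n → ℕ),
    (c p.1 * starRingEnd ℂ (c p.2) * mixedMonomial s p.1 p.2 x).re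

/-- Absolute convergence of the series `poissonSq c s` on the open polydisk of radius `ρ`. -/
def PoissonSummable (c : (Fin n → ℕ) → ℂ) (s ρ : ℝ) : Prop :=
  ∀ t, 0 ≤ t → t < ρ → Summable fun p : (Fin n → ℕ) × (Fin n → ℕ) =>
    ‖c p.1‖ * ‖c p.2‖ * mixedBound s t p.1 p.2

theorem norm_poissonSq_term_le (c : (Fin n → ℕ) → ℂ) {s t : ℝ} (hs : 0 ≤ s) {x : Fin n → ℂ}
    (hx : ∀ j, ‖x j‖ ≤ t) (p : (Fin n → ℕ) × (Fin n → ℕ)) :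
    ‖c p.1 * starRingEnd ℂ (c p.2) * mixedMonomial s p.1 p.2 x‖ ≤
      ‖c p.1‖ * ‖c p.2‖ * mixedBound s t p.1 p.2 := by
  rw [norm_mul, norm_mul, RCLike.norm_conj]
  exact mul_le_mul_of_nonneg_left (norm_mixedMonomial_le hs hx _ _) (by positivity)

theorem poissonSummable_of_lt {c : (Fin n → ℕ) → ℂ} {s ρ : ℝ}
    (hc : ∀ t, 0 ≤ t → t < ρ → Summable fun α => ‖c α‖ * t ^ (∑ j, α j)) (hs : 0 ≤ s)
    (hsρ : s < ρ) : PoissonSummable c s ρ := by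
  intro t ht htρ
  have h0 : 0 ≤ max s t := hs.trans (le_max_left _ _)
  have h1 := hc (max s t) h0 (max_lt hsρ htρ)
  refine Summable.of_nonneg_of_le
    (fun p => mul_nonneg (by positivity) (mixedBound_nonneg hs ht _ _)) (fun p => ?_)
    (h1.mul_of_nonneg h1 (fun _ => by positivity) fun _ => by positivity)
  refine (mul_le_mul_of_nonneg_left (mixedBound_mono hs (le_max_left s t) ht (le_max_right s t)
    p.1 p.2) (by positivity)).trans (le_of_eq ?_)
  rw [mixedBound_self]
  ring

/-- Off-diagonal terms decay like powers of `q = t / ρ < 1` with exponent `|α - β| + |β - α|`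
(truncated differences). By `2xy ≤ x² + y²` it suffices to sum `|c α|² ρ ^ (2|α|)` against this
decay. As `(α, β) ↦ (α, α - β, β - α)` is injective, a product of summable series dominates. -/
theorem poissonSummable_of_summable_sq {c : (Fin n → ℕ) → ℂ} {ρ : ℝ} (hρ : 0 < ρ)
    (hc : Summable fun α => (‖c α‖ * ρ ^ (∑ j, α j)) ^ 2) : PoissonSummable c ρ ρ := by
  intro t ht htρ
  have hq0 : 0 ≤ t / ρ := by positivity
  have hq1 : t / ρ < 1 := (div_lt_one hρ).2 htρ
  have hbound : ∀ α β : Fin n → ℕ, mixedBound ρ t α β =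
      ρ ^ (∑ j, α j) * ρ ^ (∑ j, β j) *
        ((t / ρ) ^ (∑ j, (α - β) j) * (t / ρ) ^ (∑ j, (β - α) j)) := by
    intro α β
    rw [← mixedBound_self, mixedBound, mixedBound, ← pow_add, ← Finset.sum_add_distrib,
      ← Finset.prod_pow_eq_pow_sum, ← Finset.prod_mul_distrib]
    refine Finset.prod_congr rfl fun j _ => ?_
    rw [mul_assoc, Pi.sub_apply, Pi.sub_apply, ← mul_pow, mul_div_cancel₀ _ hρ.ne']
  have hgeo := summable_pow_sum n hq0 hq1
  have h1 : Summable fun p : (Fin n → ℕ) × (Fin n → ℕ) =>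
      (‖c p.1‖ * ρ ^ (∑ j, p.1 j)) ^ 2 *
        ((t / ρ) ^ (∑ j, (p.1 - p.2) j) * (t / ρ) ^ (∑ j, (p.2 - p.1) j)) := by
    have h2 := hc.mul_of_nonneg (hgeo.mul_of_nonneg hgeo (fun _ => by positivity)
      fun _ => by positivity) (fun _ => by positivity) fun _ => by positivity
    refine h2.comp_injective (i := fun p : (Fin n → ℕ) × (Fin n → ℕ) =>
      (p.1, (p.1 - p.2, p.2 - p.1))) ?_
    rintro ⟨α, β⟩ ⟨α', β'⟩ h
    simp only [Prod.mk.injEq] at h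
    obtain ⟨rfl, h3, h4⟩ := h
    refine Prod.ext rfl (funext fun j => ?_)
    have h5 := congrFun h3 j
    have h6 := congrFun h4 j
    simp only [Pi.sub_apply] at h5 h6
    change β j = β' j
    omega
  have h2 : Summable fun p : (Fin n → ℕ) × (Fin n → ℕ) =>
      (‖c p.2‖ * ρ ^ (∑ j, p.2 j)) ^ 2 *
        ((t / ρ) ^ (∑ j, (p.1 - p.2) j) * (t / ρ) ^ (∑ j, (p.2 - p.1) j)) := by
    refine ((Equiv.prodComm _ _).summable_iff.2 h1).congr fun p => ?_
    simp only [Function.comp_apply, Equiv.prodComm_apply, Prod.fst_swap, Prod.snd_swap]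
    ring
  refine Summable.of_nonneg_of_le
    (fun p => mul_nonneg (by positivity) (mixedBound_nonneg hρ.le ht _ _)) (fun p => ?_)
    (h1.add h2)
  rw [hbound, ← add_mul]
  calc _ = ((‖c p.1‖ * ρ ^ (∑ j, p.1 j)) * (‖c p.2‖ * ρ ^ (∑ j, p.2 j))) *
        ((t / ρ) ^ (∑ j, (p.1 - p.2) j) * (t / ρ) ^ (∑ j, (p.2 - p.1) j)) := by ring
    _ ≤ _ := by
      refine mul_le_mul_of_nonneg_right ?_ (by positivity)
      have h3 := two_mul_le_add_sq (‖c p.1‖ * ρ ^ (∑ j, p.1 j)) (‖c p.2‖ * ρ ^ (∑ j, p.2 j))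
      have h4 : 0 ≤ (‖c p.1‖ * ρ ^ (∑ j, p.1 j)) * (‖c p.2‖ * ρ ^ (∑ j, p.2 j)) := by positivity
      linarith

theorem PoissonSummable.summable_term {c : (Fin n → ℕ) → ℂ} {s ρ : ℝ} (h : PoissonSummable c s ρ)
    (hs : 0 ≤ s) {x : Fin n → ℂ} (hx : ‖x‖ < ρ) :
    Summable fun p : (Fin n → ℕ) × (Fin n → ℕ) =>
      c p.1 * starRingEnd ℂ (c p.2) * mixedMonomial s p.1 p.2 x :=
  Summable.of_norm_bounded (h ‖x‖ (norm_nonneg x) hx)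
    (norm_poissonSq_term_le c hs fun j => norm_le_pi_norm x j)

theorem PoissonSummable.hasSum_re {c : (Fin n → ℕ) → ℂ} {s ρ : ℝ} (h : PoissonSummable c s ρ)
    (hs : 0 ≤ s) {x : Fin n → ℂ} (hx : ‖x‖ < ρ) :
    HasSum (fun p : (Fin n → ℕ) × (Fin n → ℕ) =>
      (c p.1 * starRingEnd ℂ (c p.2) * mixedMonomial s p.1 p.2 x).re) (poissonSq c s x) :=
  (Complex.hasSum_re (h.summable_term hs hx).hasSum).summable.hasSum

theorem continuous_mixedMonomial (s : ℝ) (α β : Fin n → ℕ) :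
    Continuous (mixedMonomial s α β) := by
  unfold mixedMonomial
  have := Complex.continuous_conj
  fun_prop

theorem PoissonSummable.continuousOn {c : (Fin n → ℕ) → ℂ} {s ρ : ℝ} (h : PoissonSummable c s ρ)
    (hs : 0 ≤ s) : ContinuousOn (poissonSq c s) (Metric.ball 0 ρ) := by
  intro x hx
  rw [mem_ball_zero_iff] at hx
  obtain ⟨t, hxt, htρ⟩ := exists_between hx
  have ht : 0 ≤ t := (norm_nonneg x).trans hxt.le
  have h1 : ContinuousOn (poissonSq c s) (Metric.ball 0 t) := by
    refine continuousOn_tsum (fun p => ?_) (h t ht htρ) fun p y hy => ?_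
    · exact (Complex.continuous_re.comp
        (continuous_const.mul (continuous_mixedMonomial s p.1 p.2))).continuousOn
    · rw [mem_ball_zero_iff] at hy
      exact (Complex.abs_re_le_norm _).trans
        (norm_poissonSq_term_le c hs (fun j => (norm_le_pi_norm y j).trans hy.le) p)
  exact (h1.continuousAt (Metric.isOpen_ball.mem_nhds (mem_ball_zero_iff.2 hxt))).continuousWithinAt

/-- One of the truncated differences is zero. If the conjugate power survives, conjugation makes the
term holomorphic without changing real part or modulus. -/
theorem exists_re_eq_re_mul_pow (A : ℂ) (a b : ℕ) :
    ∃ B : ℂ, ∀ v : ℂ, (A * (v ^ (a - b) * (starRingEnd ℂ v) ^ (b - a))).re =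
      (B * v ^ ((a - b) + (b - a))).re ∧
      ‖A * (v ^ (a - b) * (starRingEnd ℂ v) ^ (b - a))‖ = ‖B * v ^ ((a - b) + (b - a))‖ := by
  rcases le_total b a with h | h
  · refine ⟨A, fun v => ?_⟩
    simp [Nat.sub_eq_zero_of_le h]
  · refine ⟨starRingEnd ℂ A, fun v => ?_⟩
    simp only [Nat.sub_eq_zero_of_le h, pow_zero, one_mul, zero_add]
    constructor
    · rw [← Complex.conj_re, map_mul, map_pow, Complex.conj_conj]
    · simp

/-- In one variable every term is the real part of a monomial of equal modulus, so the same bound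
makes the monomials sum to a holomorphic function, with `poissonSq` as real part. -/
theorem PoissonSummable.isSeparatelyHarmonic {c : (Fin n → ℕ) → ℂ} {s ρ : ℝ}
    (h : PoissonSummable c s ρ) (hs : 0 ≤ s) (a : Fin n → ℂ) :
    IsSeparatelyHarmonic a ρ fun z => poissonSq c s (z - a) := by
  intro z hz j w₀ hw₀
  have hρ : 0 < ρ := (norm_nonneg _).trans_lt hw₀
  have hza : ‖z - a‖ < ρ := (mem_polydisk_iff_norm_sub_lt hρ).1 hz
  obtain ⟨t, ht1, htρ⟩ := exists_between (max_lt (show ‖w₀ - a j‖ < ρ from hw₀) hza)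
  have hwt : ‖w₀ - a j‖ < t := (le_max_left _ _).trans_lt ht1
  have hzt : ‖z - a‖ < t := (le_max_right _ _).trans_lt ht1
  have ht : 0 < t := (norm_nonneg _).trans_lt hzt
  have hupd : ∀ w, ‖w - a j‖ < t → ∀ i, ‖(Function.update z j w - a) i‖ ≤ t := by
    intro w hw i
    rcases eq_or_ne i j with rfl | hij
    · simpa using hw.le
    · rw [Pi.sub_apply, Function.update_of_ne hij]
      exact (norm_le_pi_norm (z - a) i).trans hzt.le
  have hterm : ∀ p : (Fin n → ℕ) × (Fin n → ℕ), ∃ B : ℂ, ∀ w : ℂ,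
      (c p.1 * starRingEnd ℂ (c p.2) *
        mixedMonomial s p.1 p.2 (Function.update z j w - a)).re =
        (B * (w - a j) ^ ((p.1 j - p.2 j) + (p.2 j - p.1 j))).re ∧
      ‖c p.1 * starRingEnd ℂ (c p.2) *
        mixedMonomial s p.1 p.2 (Function.update z j w - a)‖ =
        ‖B * (w - a j) ^ ((p.1 j - p.2 j) + (p.2 j - p.1 j))‖ := by
    intro p
    let A : ℂ := c p.1 * starRingEnd ℂ (c p.2) * ((s : ℂ) ^ (2 * min (p.1 j) (p.2 j)) *
      ∏ i ∈ Finset.univ.erase j, ((s : ℂ) ^ (2 * min (p.1 i) (p.2 i)) *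
        ((z - a) i ^ (p.1 i - p.2 i) * (starRingEnd ℂ ((z - a) i)) ^ (p.2 i - p.1 i))))
    obtain ⟨B, hB⟩ := exists_re_eq_re_mul_pow A (p.1 j) (p.2 j)
    refine ⟨B, fun w => ?_⟩
    have h1 : c p.1 * starRingEnd ℂ (c p.2) *
        mixedMonomial s p.1 p.2 (Function.update z j w - a) =
        A * ((w - a j) ^ (p.1 j - p.2 j) * (starRingEnd ℂ (w - a j)) ^ (p.2 j - p.1 j)) := by
      rw [mixedMonomial, ← Finset.mul_prod_erase _ _ (Finset.mem_univ j)]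
      rw [Finset.prod_congr rfl (g := fun i => ((s : ℂ) ^ (2 * min (p.1 i) (p.2 i)) *
        ((z - a) i ^ (p.1 i - p.2 i) * (starRingEnd ℂ ((z - a) i)) ^ (p.2 i - p.1 i))))
        fun i hi => by
          simp only [Pi.sub_apply, Function.update_of_ne (Finset.ne_of_mem_erase hi)]]
      simp only [Pi.sub_apply, Function.update_self, A]
      ring
    rw [h1]
    exact hB (w - a j)
  choose B hB1 hB2 using hterm
  have hnorm : ∀ p w, w ∈ Metric.ball (a j) t →
      ‖B p * (w - a j) ^ ((p.1 j - p.2 j) + (p.2 j - p.1 j))‖ ≤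
        ‖c p.1‖ * ‖c p.2‖ * mixedBound s t p.1 p.2 := by
    intro p w hw
    rw [← hB2]
    exact norm_poissonSq_term_le c hs (hupd w (mem_ball_iff_norm.1 hw)) p
  have hsum := h t ht.le htρ
  have hG : DifferentiableOn ℂ (fun w => ∑' p : (Fin n → ℕ) × (Fin n → ℕ),
      B p * (w - a j) ^ ((p.1 j - p.2 j) + (p.2 j - p.1 j))) (Metric.ball (a j) t) :=
    Complex.differentiableOn_tsum_of_summable_norm hsum (fun p => by fun_prop)
      Metric.isOpen_ball hnorm
  have hnhds : Metric.ball (a j) t ∈ 𝓝 w₀ :=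
    Metric.isOpen_ball.mem_nhds (mem_ball_iff_norm.2 hwt)
  refine (InnerProductSpace.harmonicAt_congr_nhds ?_).1
    (AnalyticAt.harmonicAt_re (hG.analyticAt hnhds))
  filter_upwards [hnhds] with w hw
  rw [Complex.re_tsum (Summable.of_norm_bounded hsum fun p => hnorm p w hw)]
  exact tsum_congr fun p => (hB1 p w).symm

end

/-! ### Taylor coefficients and the least `n`-harmonic majorant. -/

noncomputable section

variable {n : ℕ} {a : Fin n → ℂ} {ρ : ℝ} {h : polydisk a ρ → ℂ} {c : (Fin n → ℕ) → ℂ}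

theorem HasSum.re_mul_conj {ι : Type*} {f : ι → ℂ} {v : ℂ} (hf : HasSum f v) :
    HasSum (fun p : ι × ι => (f p.1 * starRingEnd ℂ (f p.2)).re) (‖v‖ ^ 2) := by
  let g : ι → ℂ := fun i => starRingEnd ℂ (f i)
  have hg : HasSum g (starRingEnd ℂ v) := Complex.hasSum_conj'.2 hf
  have h1 : Summable fun p : ι × ι => f p.1 * g p.2 :=
    summable_mul_of_summable_norm hf.summable.norm hg.summable.norm
  have h2 := Complex.hasSum_re (hf.mul hg h1)
  rwa [Complex.mul_conj, Complex.normSq_eq_norm_sq, Complex.ofReal_re] at h2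

/-- The power series around the center with coefficients `c` converges to `h` on the polydisk. -/
def HasTaylorCoeff (h : polydisk a ρ → ℂ) (c : (Fin n → ℕ) → ℂ) : Prop :=
  ∀ x : Fin n → ℂ, ‖x‖ < ρ → HasSum (fun α => c α * ∏ j, x j ^ α j) (zeroExt h (a + x))

theorem add_mem_polydisk (hρ : 0 < ρ) {x : Fin n → ℂ} (hx : ‖x‖ < ρ) : a + x ∈ polydisk a ρ := by
  rw [mem_polydisk_iff_norm_sub_lt hρ]
  simpa using hx

theorem IsAnalyticFun.exists_hasTaylorCoeff (hρ : 0 < ρ) (hh : IsAnalyticFun h) :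
    ∃ c, HasTaylorCoeff h c := by
  have h1 : AnalyticOnNhd ℂ (fun x => zeroExt h (a + x)) (Metric.ball 0 ρ) := by
    intro x hx
    rw [mem_ball_zero_iff] at hx
    exact AnalyticAt.fun_comp (f := fun x => a + x) (hh _ (add_mem_polydisk hρ hx))
      (analyticAt_const.add analyticAt_id)
  obtain ⟨c, -, hc⟩ := exists_hasSum_monomials_and_cauchy_estimate _ h1
  exact ⟨c, hc⟩

namespace HasTaylorCoeff

theorem summable (hc : HasTaylorCoeff h c) {t : ℝ} (ht : 0 ≤ t) (htρ : t < ρ) :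
    Summable fun α => ‖c α‖ * t ^ (∑ j, α j) := by
  have h1 : ‖(fun _ => (t : ℂ) : Fin n → ℂ)‖ < ρ := by
    rw [pi_norm_lt_iff (ht.trans_lt htρ)]
    intro j
    rwa [Complex.norm_real, Real.norm_of_nonneg ht]
  refine (hc _ h1).summable.norm.congr fun α => ?_
  rw [Finset.prod_pow_eq_pow_sum, norm_mul, norm_pow, Complex.norm_real, Real.norm_of_nonneg ht]

theorem unique (hρ : 0 < ρ) {d : (Fin n → ℕ) → ℂ} (hc : HasTaylorCoeff h c)
    (hd : HasTaylorCoeff h d) : c = d := by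
  refine sub_eq_zero.1 (coeff_eq_zero_of_hasSum_zero hρ (fun t ht htρ => ?_) fun z hz => ?_)
  · refine Summable.of_nonneg_of_le (fun α => by positivity) (fun α => ?_)
      ((hc.summable ht htρ).add (hd.summable ht htρ))
    rw [← add_mul]
    exact mul_le_mul_of_nonneg_right (norm_sub_le _ _) (by positivity)
  · have h1 := (hc z hz).sub (hd z hz)
    rw [sub_self] at h1
    simpa only [Pi.sub_apply, sub_mul] using h1

theorem exists_hasFPowerSeriesOnBall (hρ : 0 < ρ) (hc : HasTaylorCoeff h c) :
    ∃ p : FormalMultilinearSeries ℂ (Fin n → ℂ) ℂ,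
      HasFPowerSeriesOnBall (zeroExt h) p a (ENNReal.ofReal ρ) ∧ ∀ k y, p k (fun _ => y) =
        ∑ α ∈ (Finset.univ : Finset (Fin n)).piAntidiag k, c α * ∏ j, y j ^ α j := by
  obtain ⟨p, hp, hpc⟩ := exists_hasFPowerSeriesOnBall_monomials hρ
    (fun t ht htρ => hc.summable ht htρ) hc
  refine ⟨p, ?_, hpc⟩
  have h1 := hp.comp_sub a
  rw [zero_add] at h1
  simpa using h1

theorem isAnalyticFun (hρ : 0 < ρ) (hc : HasTaylorCoeff h c) : IsAnalyticFun h := by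
  obtain ⟨p, hp, -⟩ := hc.exists_hasFPowerSeriesOnBall hρ
  intro z hz
  refine hp.analyticAt_of_mem ?_
  rw [Metric.eball_ofReal, ← polydisk_eq_ball a hρ]
  exact hz

theorem le_zeroOrder_iff (hρ : 0 < ρ) (hc : HasTaylorCoeff h c) (k : ℕ) :
    (k : ℕ∞) ≤ zeroOrder a h ↔ ∀ α : Fin n → ℕ, ∑ j, α j < k → c α = 0 := by
  obtain ⟨p, hp, hpc⟩ := hc.exists_hasFPowerSeriesOnBall hρ
  rw [_root_.le_zeroOrder_iff hp.hasFPowerSeriesAt]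
  simp only [hpc]
  constructor
  · intro H α hα
    exact coeff_eq_zero_of_sum_monomials_eq_zero (H _ hα) α (mem_piAntidiag_univ.2 rfl)
  · intro H j hj y
    refine Finset.sum_eq_zero fun α hα => ?_
    rw [H α (by rwa [mem_piAntidiag_univ.1 hα]), zero_mul]

theorem poissonSummable (hc : HasTaylorCoeff h c) {s : ℝ} (hs : 0 ≤ s) (hsρ : s < ρ) :
    PoissonSummable c s ρ :=
  poissonSummable_of_lt (fun _ ht htρ => hc.summable ht htρ) hs hsρ

theorem poissonSq_of_mem_torus (hc : HasTaylorCoeff h c) {x : Fin n → ℂ} {s : ℝ}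
    (hx : ∀ j, ‖x j‖ = s) (hxρ : ‖x‖ < ρ) :
    poissonSq c s x = ‖zeroExt h (a + x)‖ ^ 2 := by
  rw [← (hc x hxρ).re_mul_conj.tsum_eq, poissonSq]
  refine tsum_congr fun p => ?_
  rw [mixedMonomial_of_mem_torus hx, map_mul (starRingEnd ℂ) (c p.2)]
  congr 1
  ring

/-- `|h|²` itself need not be separately harmonic. With `w = h (a + x)` fixed, `|h|² - |h - w|² = Re
(2 conj w * h - |w|²)` is; it is at most `|h|²` on the torus and equals `|h|²` at `a + x`. -/
theorem norm_sq_le_poissonSq (hρ : 0 < ρ) (hc : HasTaylorCoeff h c) {s : ℝ} (hs : 0 < s)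
    (hsρ : s < ρ) {x : Fin n → ℂ} (hx : ‖x‖ ≤ s) :
    ‖zeroExt h (a + x)‖ ^ 2 ≤ poissonSq c s x := by
  have hana : AnalyticOnNhd ℂ (zeroExt h) (polydisk a ρ) := hc.isAnalyticFun hρ
  have hsq : ∀ w v : ℂ, (2 * starRingEnd ℂ w * v - w * starRingEnd ℂ w).re =
      ‖v‖ ^ 2 - ‖v - w‖ ^ 2 := by
    intro w v
    rw [← Complex.normSq_eq_norm_sq, ← Complex.normSq_eq_norm_sq, Complex.normSq_apply,
      Complex.normSq_apply]
    simp
    ring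
  have h1 := isSeparatelyHarmonic_re (f := fun z =>
    2 * starRingEnd ℂ (zeroExt h (a + x)) * zeroExt h z -
      zeroExt h (a + x) * starRingEnd ℂ (zeroExt h (a + x)))
    ((analyticOnNhd_const.mul hana).sub analyticOnNhd_const)
  have h2 := h1.le_of_le_on_torus ((hc.poissonSummable hs.le hsρ).isSeparatelyHarmonic hs.le a)
    hs hsρ (fun z hz => ?_) (z := a + x) (fun j => by
      simpa using (norm_le_pi_norm x j).trans hx)
  · simp only [hsq, add_sub_cancel_left] at h2
    simpa using h2
  · have hz1 : ‖z - a‖ < ρ := ((pi_norm_le_iff_of_nonneg hs.le).2 fun j => (hz j).le).trans_lt hsρ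
    rw [hc.poissonSq_of_mem_torus (x := z - a) hz hz1, hsq, add_sub_cancel]
    exact sub_le_self _ (by positivity)

theorem poissonSq_le_of_majorant (hρ : 0 < ρ) (hc : HasTaylorCoeff h c)
    {v : polydisk a ρ → ℝ} (hv : v ∈ nHarmonicMajorants h) {s : ℝ} (hs : 0 < s) (hsρ : s < ρ)
    {x : Fin n → ℂ} (hx : ‖x‖ ≤ s) : poissonSq c s x ≤ zeroExt v (a + x) := by
  have h1 : IsSeparatelyHarmonic a ρ (zeroExt v) := hv.1.2
  have h2 := ((hc.poissonSummable hs.le hsρ).isSeparatelyHarmonic hs.le a).le_of_le_on_torus h1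
    hs hsρ (fun z hz => ?_) (z := a + x) (fun j => by
      simpa using (norm_le_pi_norm x j).trans hx)
  · simpa using h2
  · have hz1 : ‖z - a‖ < ρ := ((pi_norm_le_iff_of_nonneg hs.le).2 fun j => (hz j).le).trans_lt hsρ
    have hz2 : z ∈ polydisk a ρ := (mem_polydisk_iff_norm_sub_lt hρ).2 hz1
    rw [hc.poissonSq_of_mem_torus (x := z - a) hz hz1, add_sub_cancel, zeroExt_apply _ hz2, zeroExt_apply _ hz2]
    exact hv.2 ⟨z, hz2⟩

end HasTaylorCoeff

theorem PoissonSummable.hasSum_poissonSq_zero {s : ℝ} (hρ : 0 < ρ) (h : PoissonSummable c s ρ)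
    (hs : 0 ≤ s) : HasSum (fun α => (‖c α‖ * s ^ (∑ j, α j)) ^ 2) (poissonSq c s 0) := by
  have h1 := h.hasSum_re hs (x := 0) (by simpa using hρ)
  have hinj : Function.Injective fun α : Fin n → ℕ => (α, α) := fun α β h => congrArg Prod.fst h
  rw [← hinj.hasSum_iff] at h1
  · refine Eq.mpr (congrArg (fun g => HasSum g _) (funext fun α => ?_)) h1
    simp only [Function.comp_apply, mixedMonomial_zero, if_true]
    rw [Complex.mul_conj, Complex.normSq_eq_norm_sq, ← Complex.ofReal_pow, ← Complex.ofReal_mul,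
      Complex.ofReal_re]
    ring
  · intro p hp
    rw [mixedMonomial_zero, if_neg, mul_zero, Complex.zero_re]
    exact fun he => hp ⟨p.1, Prod.ext rfl he⟩

/-- Dominated convergence: the bounds increase with `s`, so the series for `s = ρ` dominates. -/
theorem PoissonSummable.tendsto_poissonSq (hρ : 0 < ρ) (h : PoissonSummable c ρ ρ)
    {x : Fin n → ℂ} (hx : ‖x‖ < ρ) :
    Tendsto (fun s => poissonSq c s x) (𝓝[<] ρ) (𝓝 (poissonSq c ρ x)) := by
  refine tendsto_tsum_of_dominated_convergence (h ‖x‖ (norm_nonneg x) hx) (fun p => ?_) ?_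
  · have h1 : Continuous fun s : ℝ =>
        (c p.1 * starRingEnd ℂ (c p.2) * mixedMonomial s p.1 p.2 x).re := by
      unfold mixedMonomial
      fun_prop
    exact h1.continuousAt.tendsto.mono_left nhdsWithin_le_nhds
  · filter_upwards [Ioo_mem_nhdsLT hρ] with s hs p
    refine (Complex.abs_re_le_norm _).trans ((norm_poissonSq_term_le c hs.1.le
      (fun j => norm_le_pi_norm x j) p).trans ?_)
    exact mul_le_mul_of_nonneg_left (mixedBound_mono hs.1.le hs.2.le (norm_nonneg x) le_rfl _ _)
      (by positivity)

namespace HasTaylorCoeff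

/-- Every finite partial sum at radius `s < ρ` is at most `poissonSq c s 0 ≤ v a`; let `s → ρ`. -/
theorem summable_sq_of_majorant (hρ : 0 < ρ) (hc : HasTaylorCoeff h c)
    {v : polydisk a ρ → ℝ} (hv : v ∈ nHarmonicMajorants h) :
    Summable fun α => (‖c α‖ * ρ ^ (∑ j, α j)) ^ 2 := by
  refine summable_of_sum_le (c := zeroExt v a) (fun _ => by positivity) fun S => ?_
  have h1 : Tendsto (fun s : ℝ => ∑ α ∈ S, (‖c α‖ * s ^ (∑ j, α j)) ^ 2) (𝓝[<] ρ)
      (𝓝 (∑ α ∈ S, (‖c α‖ * ρ ^ (∑ j, α j)) ^ 2)) := by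
    have : Continuous fun s : ℝ => ∑ α ∈ S, (‖c α‖ * s ^ (∑ j, α j)) ^ 2 := by fun_prop
    exact this.continuousAt.tendsto.mono_left nhdsWithin_le_nhds
  refine le_of_tendsto h1 ?_
  filter_upwards [Ioo_mem_nhdsLT hρ] with s hs
  have h2 := (hc.poissonSummable hs.1.le hs.2).hasSum_poissonSq_zero hρ hs.1.le
  refine (sum_le_hasSum S (fun _ _ => by positivity) h2).trans ?_
  have h3 := hc.poissonSq_le_of_majorant hρ hv hs.1 hs.2 (x := 0) (by simpa using hs.1.le)
  rwa [add_zero] at h3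

/-- The least `n`-harmonic majorant in terms of the power series. -/
theorem isLeast_poissonSq (hρ : 0 < ρ) (hc : HasTaylorCoeff h c)
    (hs : Summable fun α => (‖c α‖ * ρ ^ (∑ j, α j)) ^ 2) :
    IsLeast (nHarmonicMajorants h) fun z => poissonSq c ρ (z - a) := by
  have hP := poissonSummable_of_summable_sq hρ hs
  -- The inequalities for `poissonSq c s` hold where `‖x‖ ≤ s < ρ`, which is eventually true as `s →
  -- ρ`.
  have hev : ∀ x : Fin n → ℂ, ‖x‖ < ρ → ∀ᶠ s in 𝓝[<] ρ, 0 < s ∧ s < ρ ∧ ‖x‖ ≤ s := by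
    intro x hx
    filter_upwards [Ioo_mem_nhdsLT hρ, Ioo_mem_nhdsLT hx] with s h1 h2
    exact ⟨h1.1, h1.2, h2.1.le⟩
  refine ⟨⟨⟨?_, ?_⟩, fun z => ?_⟩, fun v hv z => ?_⟩
  · have h1 := hP.continuousOn hρ.le
    refine h1.comp_continuous (by fun_prop) fun z => ?_
    rw [mem_ball_zero_iff, ← mem_polydisk_iff_norm_sub_lt hρ]
    exact z.2
  · refine (hP.isSeparatelyHarmonic hρ.le a).congr fun z hz => ?_
    rw [zeroExt_apply _ hz]
  · have hz := (mem_polydisk_iff_norm_sub_lt hρ).1 z.2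
    refine ge_of_tendsto (hP.tendsto_poissonSq hρ hz) ?_
    filter_upwards [hev _ hz] with s hs
    have h1 := hc.norm_sq_le_poissonSq hρ hs.1 hs.2.1 hs.2.2
    rwa [add_sub_cancel, zeroExt_apply _ z.2] at h1
  · have hz := (mem_polydisk_iff_norm_sub_lt hρ).1 z.2
    refine le_of_tendsto (hP.tendsto_poissonSq hρ hz) ?_
    filter_upwards [hev _ hz] with s hs
    have h1 := hc.poissonSq_le_of_majorant hρ hv hs.1 hs.2.1 hs.2.2
    rwa [add_sub_cancel, zeroExt_apply _ z.2] at h1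

end HasTaylorCoeff

end

/-! ### The Hardy norm and the analytic Hilbert module axioms. -/

noncomputable section

section Module

variable {n : ℕ} {a : Fin n → ℂ} {ρ : ℝ} {H : Type*} [NormedAddCommGroup H]
  [InnerProductSpace ℂ H] {ι : H →ₗ[ℂ] (polydisk a ρ → ℂ)}

/-- The norm of `h` is the square root of the value at the center of the least `n`-harmonic
majorant of `|h|²`, which exists. -/
structure IsHardyNorm (hρ : 0 < ρ) (ι : H →ₗ[ℂ] (polydisk a ρ → ℂ)) : Prop where
  injective : Function.Injective ι
  analytic : ∀ h, IsAnalyticFun (ι h)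
  majorant : ∀ h, (nHarmonicMajorants (ι h)).Nonempty
  norm_sq : ∀ (h : H) (u : polydisk a ρ → ℝ), IsLeast (nHarmonicMajorants (ι h)) u →
    ‖h‖ ^ 2 = u ⟨a, center_mem_polydisk a hρ⟩

theorem exists_isLeast_nHarmonicMajorants (hρ : 0 < ρ) {h : polydisk a ρ → ℂ}
    (hh : IsAnalyticFun h) (hm : (nHarmonicMajorants h).Nonempty) :
    ∃ u, IsLeast (nHarmonicMajorants h) u := by
  obtain ⟨c, hc⟩ := hh.exists_hasTaylorCoeff hρ
  obtain ⟨v, hv⟩ := hm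
  exact ⟨_, hc.isLeast_poissonSq hρ (hc.summable_sq_of_majorant hρ hv)⟩

theorem hasSum_sq_of_isLeast (hρ : 0 < ρ) {h : polydisk a ρ → ℂ} {c : (Fin n → ℕ) → ℂ}
    (hc : HasTaylorCoeff h c) {u : polydisk a ρ → ℝ} (hu : IsLeast (nHarmonicMajorants h) u) :
    HasSum (fun α => (‖c α‖ * ρ ^ (∑ j, α j)) ^ 2) (u ⟨a, center_mem_polydisk a hρ⟩) := by
  have hs := hc.summable_sq_of_majorant hρ hu.1
  rw [hu.unique (hc.isLeast_poissonSq hρ hs)]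
  simpa only [sub_self] using
    (poissonSummable_of_summable_sq hρ hs).hasSum_poissonSq_zero hρ hρ.le

namespace IsHardyNorm

variable {hρ : 0 < ρ}

theorem hasSum_sq (hι : IsHardyNorm hρ ι) {h : H} {c : (Fin n → ℕ) → ℂ}
    (hc : HasTaylorCoeff (ι h) c) :
    HasSum (fun α => (‖c α‖ * ρ ^ (∑ j, α j)) ^ 2) (‖h‖ ^ 2) := by
  obtain ⟨u, hu⟩ := exists_isLeast_nHarmonicMajorants hρ (hι.analytic h) (hι.majorant h)
  rw [hι.norm_sq h u hu]
  exact hasSum_sq_of_isLeast hρ hc hu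

theorem norm_coeff_mul_le (hι : IsHardyNorm hρ ι) {h : H} {c : (Fin n → ℕ) → ℂ}
    (hc : HasTaylorCoeff (ι h) c) (α : Fin n → ℕ) : ‖c α‖ * ρ ^ (∑ j, α j) ≤ ‖h‖ := by
  refine le_of_sq_le_sq ?_ (norm_nonneg h)
  exact le_hasSum (hι.hasSum_sq hc) α fun _ _ => by positivity

/-- Since `|c α| ≤ ‖h‖ ρ ^ (-|α|)`, the series is dominated by a geometric one in `t / ρ`. -/
theorem norm_apply_le (hι : IsHardyNorm hρ ι) {t : ℝ} (ht : 0 ≤ t) (htρ : t < ρ) (h : H)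
    {x : Fin n → ℂ} (hx : ‖x‖ ≤ t) :
    ‖zeroExt (ι h) (a + x)‖ ≤ ‖h‖ * ∑' α : Fin n → ℕ, (t / ρ) ^ (∑ j, α j) := by
  obtain ⟨c, hc⟩ := (hι.analytic h).exists_hasTaylorCoeff hρ
  have hgeo := summable_pow_sum n (q := t / ρ) (by positivity) ((div_lt_one hρ).2 htρ)
  rw [← (hc x (hx.trans_lt htρ)).tsum_eq, ← tsum_mul_left]
  refine tsum_of_norm_bounded (hgeo.mul_left ‖h‖).hasSum fun α => ?_
  rw [norm_mul]
  have h1 : t ^ (∑ j, α j) = ρ ^ (∑ j, α j) * (t / ρ) ^ (∑ j, α j) := by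
    rw [← mul_pow, mul_div_cancel₀ _ hρ.ne']
  calc _ ≤ ‖c α‖ * t ^ (∑ j, α j) :=
        mul_le_mul_of_nonneg_left (norm_monomial_le hx α) (norm_nonneg _)
    _ = (‖c α‖ * ρ ^ (∑ j, α j)) * (t / ρ) ^ (∑ j, α j) := by rw [h1, mul_assoc]
    _ ≤ _ := mul_le_mul_of_nonneg_right (hι.norm_coeff_mul_le hc α) (by positivity)

theorem exists_continuous_coeff (hι : IsHardyNorm hρ ι) :
    ∃ d : H → (Fin n → ℕ) → ℂ, (∀ h, HasTaylorCoeff (ι h) (d h)) ∧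
      ∀ α, Continuous fun h => d h α := by
  choose d hd using fun h => (hι.analytic h).exists_hasTaylorCoeff hρ
  refine ⟨d, hd, fun α => ?_⟩
  have hsub : ∀ g h, d (g - h) = d g - d h := by
    intro g h
    refine (hd (g - h)).unique hρ fun x hx => ?_
    have h1 := (hd g x hx).sub (hd h x hx)
    rw [map_sub, zeroExt_apply _ (add_mem_polydisk hρ hx), Pi.sub_apply,
      ← zeroExt_apply (ι g) (add_mem_polydisk hρ hx),
      ← zeroExt_apply (ι h) (add_mem_polydisk hρ hx)]
    simpa only [Pi.sub_apply, sub_mul] using h1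
  have hpos : 0 < ρ ^ (∑ j, α j) := by positivity
  refine (LipschitzWith.of_dist_le_mul (K := Real.toNNReal (ρ ^ (∑ j, α j))⁻¹)
    fun g h => ?_).continuous
  rw [Real.coe_toNNReal _ (by positivity), dist_eq_norm, dist_eq_norm, ← Pi.sub_apply, ← hsub,
    le_inv_mul_iff₀ hpos, mul_comm]
  exact hι.norm_coeff_mul_le (hd (g - h)) α

/-- Order at least `k` means that the continuous coefficient functionals of degree below `k` vanish,
a closed condition. -/
theorem upperSemicontinuous_zeroOrder (hι : IsHardyNorm hρ ι) :
    UpperSemicontinuous fun h => zeroOrder a (ι h) := by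
  obtain ⟨d, hd, hcont⟩ := hι.exists_continuous_coeff
  have key : ∀ k : ℕ, IsClosed {h : H | (k : ℕ∞) ≤ zeroOrder a (ι h)} := by
    intro k
    simp only [(hd _).le_zeroOrder_iff hρ, ofPred_forall]
    exact isClosed_iInter fun α => isClosed_iInter fun _ =>
      isClosed_eq (hcont α) continuous_const
  rw [upperSemicontinuous_iff_isClosed_preimage]
  intro y
  have h1 : (fun h => zeroOrder a (ι h)) ⁻¹' Ici y =
      ⋂ (k : ℕ) (_ : (k : ℕ∞) ≤ y), {h : H | (k : ℕ∞) ≤ zeroOrder a (ι h)} := by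
    ext h
    simp only [mem_preimage, mem_Ici, mem_iInter, mem_ofPred_eq]
    exact ENat.forall_natCast_le_iff_le.symm.trans Iff.rfl
  rw [h1]
  exact isClosed_iInter fun k => isClosed_iInter fun _ => key k

theorem tendstoUniformlyOn (hι : IsHardyNorm hρ ι) {hs : ℕ → H} {h : H}
    (hlim : Tendsto hs atTop (𝓝 h)) {K : Set (Fin n → ℂ)} (hK : IsCompact K)
    (hKU : K ⊆ polydisk a ρ) :
    TendstoUniformlyOn (fun j => zeroExt (ι (hs j))) (zeroExt (ι h)) atTop K := by
  rw [polydisk_eq_ball a hρ] at hKU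
  obtain ⟨t', ht'ρ, hKt'⟩ := exists_lt_subset_ball hK.isClosed hKU
  obtain ⟨t, ht, htρ, hKt⟩ : ∃ t, 0 ≤ t ∧ t < ρ ∧ ∀ z ∈ K, ‖z - a‖ ≤ t :=
    -- The radius `t'` may be negative when `K` is empty.
    ⟨max t' 0, le_max_right _ _, max_lt ht'ρ hρ, fun z hz =>
      (mem_ball_iff_norm.1 (hKt' hz)).le.trans (le_max_left _ _)⟩
  rw [Metric.tendstoUniformlyOn_iff]
  intro ε hε
  have h1 : Tendsto (fun j => ‖h - hs j‖ * ∑' α : Fin n → ℕ, (t / ρ) ^ (∑ j, α j)) atTop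
      (𝓝 0) := by
    have h2 : Tendsto (fun j => ‖h - hs j‖) atTop (𝓝 0) := by
      simpa using ((tendsto_const_nhds (x := h)).sub hlim).norm
    simpa using h2.mul_const _
  filter_upwards [h1.eventually (gt_mem_nhds hε)] with j hj z hz
  refine lt_of_le_of_lt ?_ hj
  have h2 := hι.norm_apply_le ht htρ (h - hs j) (hKt z hz)
  have h3 : z ∈ polydisk a ρ := (mem_polydisk_iff_norm_sub_lt hρ).2 ((hKt z hz).trans_lt htρ)
  rw [add_sub_cancel, zeroExt_apply _ h3, map_sub, Pi.sub_apply] at h2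
  rwa [dist_eq_norm, zeroExt_apply _ h3, zeroExt_apply _ h3]

variable {R : Subalgebra ℂ (polydisk a ρ → ℂ)} [Module R H]

/-- If `|r| ≤ M` and `u` is the least majorant of `|h|²`, then `M² u` majorizes `|r h|²`; evaluating
at the center gives `‖r • h‖ ≤ M ‖h‖`. -/
theorem continuous_smul (hι : IsHardyNorm hρ ι) (hR : R ≤ hInfty a ρ)
    (hpt : ∀ (r : R) (h : H) (z : polydisk a ρ), ι (r • h) z = (r : polydisk a ρ → ℂ) z * ι h z)
    (r : R) : Continuous fun h : H => r • h := by
  obtain ⟨-, M, hM⟩ := hR r.2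
  have hM0 : 0 ≤ M := (norm_nonneg _).trans (hM ⟨a, center_mem_polydisk a hρ⟩)
  refine AddMonoidHomClass.continuous_of_bound (DistribSMul.toAddMonoidHom H r) M fun h => ?_
  obtain ⟨u, hu⟩ := exists_isLeast_nHarmonicMajorants hρ (hι.analytic h) (hι.majorant h)
  obtain ⟨v, hv⟩ := exists_isLeast_nHarmonicMajorants hρ (hι.analytic (r • h))
    (hι.majorant (r • h))
  have h1 : M ^ 2 • u ∈ nHarmonicMajorants (ι (r • h)) := by
    refine ⟨hu.1.1.const_smul _, fun z => ?_⟩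
    rw [hpt, norm_mul, mul_pow]
    exact mul_le_mul (pow_le_pow_left₀ (norm_nonneg _) (hM z) 2) (hu.1.2 z) (by positivity)
      (by positivity)
  have h2 := hv.2 h1 ⟨a, center_mem_polydisk a hρ⟩
  rw [Pi.smul_apply, ← hι.norm_sq _ v hv, ← hι.norm_sq _ u hu, smul_eq_mul, ← mul_pow] at h2
  exact le_of_sq_le_sq h2 (by positivity)

theorem exists_beurlingDescription [CompleteSpace H] (hι : IsHardyNorm hρ ι) (hR : R ≤ hInfty a ρ)
    (hpt : ∀ (r : R) (h : H) (z : polydisk a ρ), ι (r • h) z = (r : polydisk a ρ → ℂ) z * ι h z) :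
    ∃ hP : IsAnalyticHilbertModule (polydisk a ρ) a R ι, hP.valuation.BeurlingDescription := by
  have ha := center_mem_polydisk a hρ
  have hconn : IsConnected (polydisk a ρ) := by
    rw [polydisk_eq_ball a hρ]
    exact (convex_ball a ρ).isConnected ⟨a, Metric.mem_ball_self hρ⟩
  have hRa : ∀ r : R, IsAnalyticFun (r : polydisk a ρ → ℂ) := fun r => (hR r.2).1
  have hcongr : ∀ r : R, ∀ h : H, ι (r • h) = (r : polydisk a ρ → ℂ) * ι h := fun r h =>
    funext fun z => hpt r h z
  have hP : IsAnalyticHilbertModule (polydisk a ρ) a R ι :=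
    { isOpen := isOpen_polydisk a ρ
      isConnected := hconn
      base_mem := ha
      analytic_algebra := fun r hr => (hR hr).1
      injective := hι.injective
      analytic_space := hι.analytic
      pointwise := hpt
      valuation :=
        { complete := inferInstance
          smul_assoc := fun c r h => hι.injective <| by
            rw [ι.map_smul c, hcongr, hcongr]
            exact smul_mul_assoc c (r : polydisk a ρ → ℂ) (ι h)
          continuous_smul := hι.continuous_smul hR hpt
          algebraValuation :=
            { ord_unit := fun r hr => by
                by_contra hne
                have h1 := (one_le_zeroOrder_iff (hRa r a ha)).1 (Order.one_le_iff_ne_zero.2 hne)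
                obtain ⟨s, hs⟩ := hr.exists_right_inv
                have h2 := congrFun (congrArg Subtype.val hs) ⟨a, ha⟩
                rw [zeroExt_apply _ ha] at h1
                have h3 : (r : polydisk a ρ → ℂ) ⟨a, ha⟩ * (s : polydisk a ρ → ℂ) ⟨a, ha⟩ = 1 := h2
                rw [h1, zero_mul] at h3
                exact zero_ne_one h3
              ord_eq_top_iff := fun r =>
                (zeroOrder_eq_top_iff hconn.isPreconnected ha (hRa r)).trans (by simp)
              ord_mul := fun r s => zeroOrder_add_le_mul (hRa r a ha) (hRa s a ha)
              ord_smul := fun c r hc => zeroOrder_smul (hRa r a ha) hc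
              ord_add := fun r s => min_zeroOrder_le_add (hRa r a ha) (hRa s a ha) }
          moduleValuation :=
            { ord_eq_top_iff := fun h =>
                (zeroOrder_eq_top_iff hconn.isPreconnected ha (hι.analytic h)).trans
                  (map_eq_zero_iff ι hι.injective)
              ord_mod_smul := fun r h => by
                rw [hcongr]
                exact zeroOrder_add_le_mul (hRa r a ha) (hι.analytic h a ha)
              ord_smul := fun c h hc => by
                rw [map_smul]
                exact zeroOrder_smul (hι.analytic h a ha) hc
              ord_add := fun g h => by
                rw [map_add]
                exact min_zeroOrder_le_add (hι.analytic g a ha) (hι.analytic h a ha)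
              upperSemicontinuous := hι.upperSemicontinuous_zeroOrder } }
      locally_uniform := ⟨polydisk a ρ, isOpen_polydisk a ρ, ha, subset_rfl,
        fun _ _ hlim _ hK hKU => hι.tendstoUniformlyOn hlim hK hKU⟩ }
  -- Subtracting the constant `r(a)` leaves a function vanishing at `a`, that is, of order at least
  -- one.
  refine ⟨hP, hP.valuation.beurlingDescription fun r => ⟨(r : polydisk a ρ → ℂ) ⟨a, ha⟩, ?_⟩⟩
  refine (one_le_zeroOrder_iff (hRa _ a ha)).2 ?_
  rw [zeroExt_apply _ ha]
  exact sub_self _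

end IsHardyNorm

end Module

/-! ### The isomorphism of `H²` with `ℓ²` and the transported inner product. -/

namespace HardySpace

variable {n : ℕ} {a : Fin n → ℂ} {ρ : ℝ}

/-- The power series coefficients at the center of a function in the Hardy space. -/
def coeff (h : HardySpace a ρ) : (Fin n → ℕ) → ℂ :=
  Classical.epsilon (HasTaylorCoeff (toFun a ρ h))

theorem hasTaylorCoeff_coeff (hρ : 0 < ρ) (h : HardySpace a ρ) :
    HasTaylorCoeff (toFun a ρ h) h.coeff :=
  Classical.epsilon_spec (IsAnalyticFun.exists_hasTaylorCoeff hρ h.2.1)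

theorem memℓp_coeff (hρ : 0 < ρ) (h : HardySpace a ρ) :
    Memℓp (fun α => h.coeff α * (ρ : ℂ) ^ (∑ j, α j)) 2 := by
  obtain ⟨v, hv⟩ := h.2.2
  rw [memℓp_gen_iff (by norm_num)]
  refine ((hasTaylorCoeff_coeff hρ h).summable_sq_of_majorant hρ hv).congr fun α => ?_
  rw [norm_mul, norm_pow, Complex.norm_real, Real.norm_of_nonneg hρ.le]
  norm_num

/-- The weighted power series coefficients, as a linear map to `ℓ²`. -/
def toL2 (a : Fin n → ℂ) (hρ : 0 < ρ) :
    HardySpace a ρ →ₗ[ℂ] lp (fun _ : Fin n → ℕ => ℂ) 2 where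
  toFun h := ⟨fun α => h.coeff α * (ρ : ℂ) ^ (∑ j, α j), memℓp_coeff hρ h⟩
  map_add' g h := by
    have h1 : (g + h).coeff = g.coeff + h.coeff := by
      refine (hasTaylorCoeff_coeff hρ (g + h)).unique hρ fun x hx => ?_
      have h2 := (hasTaylorCoeff_coeff hρ g x hx).add (hasTaylorCoeff_coeff hρ h x hx)
      rw [map_add, zeroExt_add]
      simpa only [Pi.add_apply, add_mul] using h2
    ext α
    change (g + h).coeff α * _ = g.coeff α * _ + h.coeff α * _
    rw [h1, Pi.add_apply, add_mul]
  map_smul' c h := by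
    have h1 : (c • h).coeff = c • h.coeff := by
      refine (hasTaylorCoeff_coeff hρ (c • h)).unique hρ fun x hx => ?_
      have h2 := (hasTaylorCoeff_coeff hρ h x hx).mul_left c
      rw [map_smul, zeroExt_smul]
      simpa only [Pi.smul_apply, smul_eq_mul, mul_assoc] using h2
    ext α
    change (c • h).coeff α * _ = c * (h.coeff α * _)
    rw [h1, Pi.smul_apply, smul_eq_mul, mul_assoc]

theorem toL2_apply (hρ : 0 < ρ) (h : HardySpace a ρ) (α : Fin n → ℕ) :
    toL2 a hρ h α = h.coeff α * (ρ : ℂ) ^ (∑ j, α j) := rfl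

theorem toL2_injective (hρ : 0 < ρ) : Function.Injective (toL2 a hρ) := by
  rw [injective_iff_map_eq_zero]
  intro h hh
  have h1 : h.coeff = 0 := by
    funext α
    have h2 : toL2 a hρ h α = 0 := by rw [hh]; rfl
    rw [toL2_apply] at h2
    exact (mul_eq_zero.1 h2).resolve_right (pow_ne_zero _ (Complex.ofReal_ne_zero.2 hρ.ne'))
  refine Subtype.ext (funext fun z => ?_)
  have hz := (mem_polydisk_iff_norm_sub_lt hρ).1 z.2
  have h3 := hasTaylorCoeff_coeff hρ h _ hz
  simp only [h1, Pi.zero_apply, zero_mul] at h3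
  rw [add_sub_cancel, zeroExt_apply _ z.2] at h3
  exact h3.unique hasSum_zero

/-- Dividing the sequence by `ρ ^ |α|` gives coefficients with `|c α| ρ ^ |α|` bounded, so the
series converges on the polydisk; square summability makes `poissonSq c ρ` a majorant. -/
theorem toL2_surjective (hρ : 0 < ρ) : Function.Surjective (toL2 a hρ) := by
  intro g
  have hρ' : (ρ : ℂ) ≠ 0 := Complex.ofReal_ne_zero.2 hρ.ne'
  let c : (Fin n → ℕ) → ℂ := fun α => g α / (ρ : ℂ) ^ (∑ j, α j)
  have hcg : ∀ α, c α * (ρ : ℂ) ^ (∑ j, α j) = g α := fun α =>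
    div_mul_cancel₀ _ (pow_ne_zero _ hρ')
  have hcn : ∀ α, ‖c α‖ * ρ ^ (∑ j, α j) = ‖g α‖ := by
    intro α
    rw [← hcg, norm_mul, norm_pow, Complex.norm_real, Real.norm_of_nonneg hρ.le]
  let f : polydisk a ρ → ℂ := fun z => ∑' α, c α * ∏ j, ((z : Fin n → ℂ) - a) j ^ α j
  have hf : HasTaylorCoeff f c := by
    intro x hx
    have h1 : Summable fun α => ‖c α‖ * ‖x‖ ^ (∑ j, α j) :=
      summable_norm_mul_pow_of_le (norm_nonneg x) hx (M := ‖g‖) fun α => by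
        rw [hcn]
        exact lp.norm_apply_le_norm two_ne_zero g α
    rw [zeroExt_apply _ (add_mem_polydisk hρ hx)]
    simp only [f, add_sub_cancel_left]
    exact (summable_norm_monomials h1 le_rfl).of_norm.hasSum
  have hsum : Summable fun α => (‖c α‖ * ρ ^ (∑ j, α j)) ^ 2 := by
    refine ((memℓp_gen_iff (by norm_num)).1 (lp.memℓp g)).congr fun α => ?_
    rw [hcn]
    norm_num
  let h : HardySpace a ρ := ⟨f, hf.isAnalyticFun hρ, _, (hf.isLeast_poissonSq hρ hsum).1⟩
  refine ⟨h, ?_⟩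
  ext α
  rw [toL2_apply, (hasTaylorCoeff_coeff hρ h).unique hρ (d := c) hf]
  exact hcg α

/-- The Hardy space is linearly isomorphic to `ℓ²`. -/
def equivL2 (a : Fin n → ℂ) (hρ : 0 < ρ) :
    HardySpace a ρ ≃ₗ[ℂ] lp (fun _ : Fin n → ℕ => ℂ) 2 :=
  LinearEquiv.ofBijective (toL2 a hρ) ⟨toL2_injective hρ, toL2_surjective hρ⟩

end HardySpace

/-- The inner product transported along a linear isomorphism. -/
@[reducible] def innerProductCoreOfLinearEquiv {E F : Type*} [AddCommGroup E] [Module ℂ E]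
    [NormedAddCommGroup F] [InnerProductSpace ℂ F] (e : E ≃ₗ[ℂ] F) :
    InnerProductSpace.Core ℂ E where
  inner x y := inner ℂ (e x) (e y)
  conj_inner_symm x y := inner_conj_symm (e x) (e y)
  re_inner_nonneg x := inner_self_nonneg
  add_left x y z := by rw [map_add, inner_add_left]
  smul_left x y r := by rw [map_smul, inner_smul_left]
  definite x hx := by simpa using hx

theorem norm_innerProductCoreOfLinearEquiv {E F : Type*} [AddCommGroup E] [Module ℂ E]
    [NormedAddCommGroup F] [InnerProductSpace ℂ F] (e : E ≃ₗ[ℂ] F) (x : E) :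
    letI := (innerProductCoreOfLinearEquiv e).toNormedAddCommGroup
    ‖x‖ = ‖e x‖ := by
  rw [norm_eq_sqrt_re_inner (𝕜 := ℂ) (e x)]
  rfl

theorem completeSpace_innerProductCoreOfLinearEquiv {E F : Type*} [AddCommGroup E]
    [Module ℂ E] [NormedAddCommGroup F] [InnerProductSpace ℂ F] [CompleteSpace F]
    (e : E ≃ₗ[ℂ] F) :
    letI := (innerProductCoreOfLinearEquiv e).toNormedAddCommGroup
    CompleteSpace E := by
  let := (innerProductCoreOfLinearEquiv e).toNormedAddCommGroup
  have h1 : Isometry e := AddMonoidHomClass.isometry_of_norm e fun x =>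
    (norm_innerProductCoreOfLinearEquiv e x).symm
  exact (IsometryEquiv.mk e.toEquiv h1).completeSpace

end

theorem theorem14p2 (n : ℕ) (hn : 1 ≤ n) (a : Fin n → ℂ) (ρ : ℝ) (hρ : 0 < ρ) :
    (∀ h : HardySpace a ρ, ∃ u, IsLeast (nHarmonicMajorants (HardySpace.toFun a ρ h)) u) ∧
    ∃ core : InnerProductSpace.Core ℂ (HardySpace a ρ),
      letI : NormedAddCommGroup (HardySpace a ρ) := core.toNormedAddCommGroup
      letI : InnerProductSpace ℂ (HardySpace a ρ) := InnerProductSpace.ofCore core.toCore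
      (∀ (h : HardySpace a ρ) (u : polydisk a ρ → ℝ),
        IsLeast (nHarmonicMajorants (HardySpace.toFun a ρ h)) u →
          ‖h‖ ^ 2 = u ⟨a, center_mem_polydisk a hρ⟩) ∧
      (∃ hP : IsAnalyticHilbertModule (polydisk a ρ) a (polyAlg a ρ) (HardySpace.toFun a ρ),
        hP.valuation.BeurlingDescription) ∧
      (∃ hB : IsAnalyticHilbertModule (polydisk a ρ) a (hInfty a ρ) (HardySpace.toFun a ρ),
        hB.valuation.BeurlingDescription) := by
  refine ⟨fun h => exists_isLeast_nHarmonicMajorants hρ h.2.1 h.2.2,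
    innerProductCoreOfLinearEquiv (HardySpace.equivL2 a hρ), ?_⟩
  let : NormedAddCommGroup (HardySpace a ρ) :=
    (innerProductCoreOfLinearEquiv (HardySpace.equivL2 a hρ)).toNormedAddCommGroup
  let : InnerProductSpace ℂ (HardySpace a ρ) :=
    InnerProductSpace.ofCore (innerProductCoreOfLinearEquiv (HardySpace.equivL2 a hρ)).toCore
  have : CompleteSpace (HardySpace a ρ) :=
    completeSpace_innerProductCoreOfLinearEquiv (HardySpace.equivL2 a hρ)
  have hnorm : ∀ (h : HardySpace a ρ) (u : polydisk a ρ → ℝ),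
      IsLeast (nHarmonicMajorants (HardySpace.toFun a ρ h)) u →
        ‖h‖ ^ 2 = u ⟨a, center_mem_polydisk a hρ⟩ := by
    intro h u hu
    -- The value `u a` and the squared `ℓ²` norm are sums of the same series.
    have h1 := hasSum_sq_of_isLeast hρ (HardySpace.hasTaylorCoeff_coeff hρ h) hu
    have h2 := lp.hasSum_norm (p := 2) (by norm_num) (HardySpace.equivL2 a hρ h)
    rw [norm_innerProductCoreOfLinearEquiv (HardySpace.equivL2 a hρ) h]
    have h3 : ∀ α, ‖HardySpace.equivL2 a hρ h α‖ = ‖h.coeff α‖ * ρ ^ (∑ j, α j) := by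
      intro α
      change ‖h.coeff α * (ρ : ℂ) ^ (∑ j, α j)‖ = _
      rw [norm_mul, norm_pow, Complex.norm_real, Real.norm_of_nonneg hρ.le]
    simp only [ENNReal.toReal_ofNat, Real.rpow_ofNat, h3] at h2
    exact h2.unique h1
  have hι : IsHardyNorm hρ (HardySpace.toFun a ρ) :=
    { injective := Subtype.val_injective
      analytic := fun h => h.2.1
      majorant := fun h => h.2.2
      norm_sq := hnorm }
  exact ⟨hnorm, hι.exists_beurlingDescription (polyAlg_le_hInfty a ρ) fun _ _ _ => rfl,
    hι.exists_beurlingDescription le_rfl fun _ _ _ => rfl⟩
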